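/- **Implicit regularisation for convex, Lipschitz and smooth losses.** *Setting.* Let $n,m,d\ge 1$, let $(V,E)$ be a simple undirected graph with $V=\{1,\dots,n\}$, and let $P\in\mathbb{R}^{n\times n}$ be a doubly stochastic matrix with $P_{vw}\neq 0$ only if $v=w$ or $\{v,w\}\in E$. Assume that $P$ is normal (for instance symmetric) and that $\sigma_2(P)<1$, where $\sigma_2(P)$ is the second largest absolute value of the eigenvalues of $P$, counted with multiplicity ($\sigma_2(P)=0$ if $n=1$). Let $Z_{v,i}$ ($v\in V$, $1\le i\le m$) be i.i.d. with the law of a random variable $Z$ with values in $\mathcal Z$, and let $\ell:\mathbb{R}^d\times\mathcal Z\to\mathbb{R}$ be measurable and integrable in its second argument and such that, for every $z$, $\ell(\cdot,z)$ is convex, $L$-Lipschitz, and differentiable with $\beta$-Lipschitz gradient ($L,\beta>0$, Euclidean norm). Put $r(x)=\mathbf{E}\,\ell(x,Z)$, $R_v(x)=\frac1m\sum_i\ell(x,Z_{v,i})$, $R=\frac1n\sum_vR_v$. Assume that $r$ has a minimiser $x^\star$ and that, almost surely, $R$ has a minimiser $X^\star$ with $\|X^\star\|\le G$, where $G>0$.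 Distributed SGD with step size $\eta>0$ is $X_v^1=0$ and $$X_v^{s+1}=\sum_{w\in V}P_{vw}\big(X_w^s-\eta\nabla\ell(X_w^s,Z_{w,K_w^{s+1}})\big),\qquad s\ge1,$$ where each $K_v^s$ is uniform on $\{1,\dots,m\}$, the vectors $(K_v^s)_{v\in V}$, $s\ge2$, are independent, and they are jointly independent of the data. Let $\sigma,\kappa>0$ be such that, along the run considered, for all $v\in V$, $s\ge1$, $$\mathbf{E}\|\nabla\ell(X_v^s,Z_{v,K_v^{s+1}})-\nabla R_v(X_v^s)\|^2\le\sigma^2,\qquad \mathbf{E}\Big\|\nabla\ell(X_v^s,Z_{v,K_v^{s+1}})-\frac1n\sum_{w\in V}\nabla R_w(X_w^s)\Big\|^2\le\kappa^2 .$$ *Step sizes and times.* For a time horizon $t\ge1$ write $\Lambda=\log((t+1)\sqrt n)$ and $\gamma=1-\sigma_2(P)$. With $\eta=1/(\beta+1/\rho)$ and a constant $c>0$, consider the choices $$\rho^\star=\frac{G}{Lc\sqrt t},\qquad \rho^\star_{\mathrm{Opt}}=\frac{G}{\sqrt t}\Big(6L\kappa\frac{\Lambda}{\gamma}+\sigma^2\Big)^{-1/2},\qquad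 \rho^\star_{\mathrm{Test}}=\frac{G}{\sqrt t}\Big(6L\kappa\frac{\Lambda}{\gamma}+\sigma^2+\frac{2L^2(t+1)}{nm}\Big)^{-1/2}.$$ Let $\mathrm{Err}_v(\rho,t)=\mathbf{E}\,r\big(\frac1t\sum_{s=1}^tX_v^{s+1}\big)-r(x^\star)$ be the Test Error of node $v$ for the run with $\eta=1/(\beta+1/\rho)$. *Claim.* (i) $\rho^\star_{\mathrm{Opt}}$ is the unique minimiser over $\rho>0$ of $\frac\rho2\sigma^2+\frac{G^2}{2t\rho}+3L\kappa\rho\frac{\Lambda}{\gamma}$, and $\rho^\star_{\mathrm{Test}}$ is the unique minimiser over $\rho>0$ of $\frac\rho2\sigma^2+\frac{G^2}{2t\rho}+3L\kappa\rho\frac{\Lambda}{\gamma}+\frac{\rho L^2}{nm}(t+1)$ (the first-order terms in $\rho$ of the Optimisation Error bound and of the Test Error bound). (ii) The function $\tau\mapsto\frac{3\kappa}{\gamma\sqrt\tau}+\frac{2L}{nm}\sqrt\tau$ (the leading terms of the bound for $\rho^\star$ at time $\tau$, up to a common factor and logarithms) has the unique minimiser $\tau=\frac{3\kappa}{2L}\frac{nm}{\gamma}$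 over $\tau>0$; the function $\tau\mapsto\sqrt{\frac{6L\kappa}{\tau\gamma}}+\frac{2L^2}{nm}\sqrt{\frac{\tau\gamma}{6L\kappa}}$ (the leading terms of the bound for $\rho^\star_{\mathrm{Opt}}$, up to a common factor, with $\tau=t/\Lambda$) has the unique minimiser $\tau=\frac{3\kappa}{L}\frac{nm}{\gamma}$ over $\tau>0$. (iii) For every $A>0$ and $j\in\mathbb{N}$ there are $C>0$ and $k\in\mathbb{N}$, depending only on $L,\beta,G,\sigma,\kappa,c,A,j$, such that the following holds in the above setting for all $n,m,d$, all $t\ge1$, all graphs and matrices $P$, all data distributions and losses, and all $v\in V$. * $\rho^\star\le \dfrac{C}{\sqrt t}$, $\quad\rho^\star_{\mathrm{Opt}}\le C\Lambda^k\sqrt{\dfrac{\gamma}{t}}$, $\quad\rho^\star_{\mathrm{Test}}\le C\Lambda^k\,\dfrac1{\sqrt t}\,\dfrac1{\sqrt{9/\gamma+t/(nm)}}$. * $\mathrm{Err}_v(\rho^\star,t)\le C\Lambda^k\Big(\dfrac1{\gamma\sqrt t}+\dfrac{\sqrt t}{nm}\Big)$, and $\mathrm{Err}_v(\rho^\star,t)\le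 \dfrac{C\Lambda^k}{\sqrt{nm\,\gamma}}$ if $\dfrac{nm}{\gamma}\le A\Lambda^jt$ and $t\le A\Lambda^j\dfrac{nm}{\gamma}$. * $\mathrm{Err}_v(\rho^\star_{\mathrm{Opt}},t)\le C\Lambda^k\Big(\dfrac1{\sqrt{t\gamma}}+\dfrac{\sqrt{t\gamma}}{nm}\Big)$, and $\mathrm{Err}_v(\rho^\star_{\mathrm{Opt}},t)\le \dfrac{C\Lambda^k}{\sqrt{nm}}$ if $\dfrac{nm}{\gamma}\le A\Lambda^jt$ and $t\le A\Lambda^j\dfrac{nm}{\gamma}$. * $\mathrm{Err}_v(\rho^\star_{\mathrm{Test}},t)\le C\Lambda^k\Big(\dfrac1{\sqrt{t\gamma}}+\dfrac1{\sqrt{nm}}\Big)$, and $\mathrm{Err}_v(\rho^\star_{\mathrm{Test}},t)\le \dfrac{C\Lambda^k}{\sqrt{nm}}$ if $\dfrac{nm}{\gamma}\le A\Lambda^jt$. -/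

import Mathlib

open MeasureTheory ProbabilityTheory
open scoped Matrix

noncomputable section

namespace DistSGD

/-- The parameter space `ℝ^d` with the Euclidean norm. -/
abbrev Param (d : ℕ) : Type := EuclideanSpace ℝ (Fin d)

/-! ### Communication matrix -/

/-- `σ₂(P)`: list the eigenvalues of `P` with multiplicity, take absolute values, sort in
decreasing order, and return the second entry (`0` if `P` has only one eigenvalue). -/
def secondEigenvalue {n : ℕ} (P : Matrix (Fin n) (Fin n) ℝ) : ℝ :=
  (((P.map (algebraMap ℝ ℂ)).charpoly.roots.map (fun a : ℂ => ‖a‖)).sort (· ≥ ·)).getD 1 0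

/-- The spectral gap `1 - σ₂(P)`. -/
def gap {n : ℕ} (P : Matrix (Fin n) (Fin n) ℝ) : ℝ := 1 - secondEigenvalue P

/-- `P` is a doubly stochastic matrix supported on the graph (a node may also keep its own value),
it is normal (in particular, it may be any symmetric matrix), and it has a positive spectral gap. -/
structure IsCommMatrix {n : ℕ} (graph : SimpleGraph (Fin n)) (P : Matrix (Fin n) (Fin n) ℝ) :
    Prop where
  doublyStochastic : P ∈ doublyStochastic ℝ (Fin n)
  supported : ∀ v w, v ≠ w → P v w ≠ 0 → graph.Adj v w
  normal : P * Pᵀ = Pᵀ * P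
  gap_pos : 0 < gap P

/-! ### Risks -/

/-- The test risk `r(x) = E ℓ(x, Z)`, where `Z` has law `μ`. -/
def testRisk {d : ℕ} {𝒵 : Type*} [MeasurableSpace 𝒵] (μ : Measure 𝒵) (ℓ : Param d → 𝒵 → ℝ)
    (x : Param d) : ℝ :=
  ∫ z, ℓ x z ∂μ

/-- The empirical risk `R(x) = (1 / (n m)) ∑_v ∑_i ℓ(x, Z_{v,i})` of the dataset `D`. -/
def empRisk {d n m : ℕ} {𝒵 : Type*} (ℓ : Param d → 𝒵 → ℝ) (D : Fin n → Fin m → 𝒵)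
    (x : Param d) : ℝ :=
  (1 / ((n : ℝ) * m)) * ∑ v, ∑ i, ℓ x (D v i)

/-- The local empirical risk `R_v(x) = (1 / m) ∑_i ℓ(x, Z_{v,i})` of a local dataset. -/
def localRisk {d m : ℕ} {𝒵 : Type*} (ℓ : Param d → 𝒵 → ℝ) (D : Fin m → 𝒵) (x : Param d) : ℝ :=
  (1 / (m : ℝ)) * ∑ i, ℓ x (D i)

/-- The gradient of `ℓ(·, z)` at `x`. -/
def lossGrad {d : ℕ} {𝒵 : Type*} (ℓ : Param d → 𝒵 → ℝ) (x : Param d) (z : 𝒵) : Param d :=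
  gradient (fun y => ℓ y z) x

/-! ### Distributed SGD -/

/-- Distributed SGD with step size `η` on the dataset `D`, started at zero:
`X_v^{s+1} = ∑_w P_{vw} (X_w^s - η ∇ℓ(X_w^s, Z_{w, K_w}))`.
Time is counted from zero: `iterate ℓ P η D K s v` is the `(s+1)`-st vector of node `v`, and
`K s w` is the index of the data point that node `w` uses to pass from time `s` to `s + 1`. -/
def iterate {d n m : ℕ} {𝒵 : Type*} (ℓ : Param d → 𝒵 → ℝ) (P : Matrix (Fin n) (Fin n) ℝ) (η : ℝ)
    (D : Fin n → Fin m → 𝒵) (K : ℕ → Fin n → Fin m) : ℕ → Fin n → Param d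
  | 0 => fun _ => 0
  | s + 1 => fun v => ∑ w, P v w •
      (iterate ℓ P η D K s w - η • lossGrad ℓ (iterate ℓ P η D K s w) (D w (K s w)))

/-- The time average `(1 / t) ∑_{s=1}^t` of the vectors of node `v` after `1, …, t` updates. -/
def average {d n m : ℕ} {𝒵 : Type*} (ℓ : Param d → 𝒵 → ℝ) (P : Matrix (Fin n) (Fin n) ℝ) (η : ℝ)
    (D : Fin n → Fin m → 𝒵) (K : ℕ → Fin n → Fin m) (t : ℕ) (v : Fin n) : Param d :=
  (1 / (t : ℝ)) • ∑ s ∈ Finset.Icc 1 t, iterate ℓ P η D K s v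

/-- The step size `η = 1 / (β + 1 / ρ)`. -/
def stepSize (β ρ : ℝ) : ℝ := 1 / (β + 1 / ρ)

/-! ### Standing assumptions -/

/-- The loss is measurable and integrable in the data point, and for every data point it is convex,
`L`-Lipschitz and `β`-smooth in the parameter. -/
structure IsSmoothLoss {d : ℕ} {𝒵 : Type*} [MeasurableSpace 𝒵] (μ : Measure 𝒵)
    (ℓ : Param d → 𝒵 → ℝ) (L β : ℝ) : Prop where
  measurable : ∀ x, Measurable (ℓ x)
  integrable : ∀ x, Integrable (ℓ x) μ
  convex : ∀ z, ConvexOn ℝ Set.univ (fun x => ℓ x z)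
  lipschitz : ∀ z x y, |ℓ x z - ℓ y z| ≤ L * ‖x - y‖
  differentiable : ∀ z, Differentiable ℝ (fun x => ℓ x z)
  smooth : ∀ z x y, ‖lossGrad ℓ x z - lossGrad ℓ y z‖ ≤ β * ‖x - y‖

/-- The data points `Z v i` are i.i.d. with law `μ`. The indices `K s v` are uniform; the vectors
`K s = (K s v)_v` are independent for different `s`, and jointly independent of the data. (Nothing
is required about the dependence of `K s v` and `K s w` for two nodes at the same time.) -/
structure IsSampling {n m : ℕ} {𝒵 Ω : Type*} [MeasurableSpace 𝒵] [MeasurableSpace Ω]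
    (Pr : Measure Ω) (μ : Measure 𝒵) (Z : Fin n → Fin m → Ω → 𝒵) (K : ℕ → Ω → Fin n → Fin m) :
    Prop where
  measurable_data : ∀ v i, Measurable (Z v i)
  law_data : ∀ v i, Pr.map (Z v i) = μ
  indep_data : iIndepFun (fun p : Fin n × Fin m => Z p.1 p.2) Pr
  measurable_index : ∀ s, Measurable (K s)
  uniform_index : ∀ s v k, Pr.real {ω | K s ω v = k} = 1 / (m : ℝ)
  indep_index : iIndepFun K Pr
  indep_data_index : IndepFun (fun ω v i => Z v i ω) (fun ω s => K s ω) Pr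

/-- Almost surely, `X⋆` is a minimiser of the empirical risk, and `‖X⋆‖ ≤ G`. -/
def IsEmpMinimiser {d n m : ℕ} {𝒵 Ω : Type*} [MeasurableSpace Ω] (Pr : Measure Ω)
    (ℓ : Param d → 𝒵 → ℝ) (Z : Fin n → Fin m → Ω → 𝒵) (G : ℝ) (Xstar : Ω → Param d) : Prop :=
  ∀ᵐ ω ∂Pr, IsMinOn (empRisk ℓ (fun v i => Z v i ω)) Set.univ (Xstar ω) ∧ ‖Xstar ω‖ ≤ G

/-- Along Distributed SGD with step size `η`, for every node and time, the variance of the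
stochastic gradient is at most `σ²`, and the mean square deviation of the stochastic gradient from
the network average of the local gradients is at most `κ²`. -/
def GradientBounds {d n m : ℕ} {𝒵 Ω : Type*} [MeasurableSpace Ω] (Pr : Measure Ω)
    (ℓ : Param d → 𝒵 → ℝ) (P : Matrix (Fin n) (Fin n) ℝ) (Z : Fin n → Fin m → Ω → 𝒵)
    (K : ℕ → Ω → Fin n → Fin m) (σ κ η : ℝ) : Prop :=
  let X : Ω → ℕ → Fin n → Param d :=
    fun ω => iterate ℓ P η (fun v i => Z v i ω) (fun s => K s ω)
  let localGrad : Ω → ℕ → Fin n → Param d :=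
    fun ω s w => gradient (localRisk ℓ (fun i => Z w i ω)) (X ω s w)
  let stochGrad : Ω → ℕ → Fin n → Param d :=
    fun ω s v => lossGrad ℓ (X ω s v) (Z v (K s ω v) ω)
  ∀ v s,
    ∫ ω, ‖stochGrad ω s v - localGrad ω s v‖ ^ 2 ∂Pr ≤ σ ^ 2 ∧
    ∫ ω, ‖stochGrad ω s v - (1 / (n : ℝ)) • ∑ w, localGrad ω s w‖ ^ 2 ∂Pr ≤ κ ^ 2

/-- The test error `E r((1 / t) ∑_{s=1}^t X_v^{s+1}) - r(x⋆)` of node `v` is at most `B` (and the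
expectation exists). -/
def TestErrorLE {d n m : ℕ} {𝒵 Ω : Type*} [MeasurableSpace 𝒵] [MeasurableSpace Ω]
    (Pr : Measure Ω) (μ : Measure 𝒵) (ℓ : Param d → 𝒵 → ℝ) (P : Matrix (Fin n) (Fin n) ℝ)
    (Z : Fin n → Fin m → Ω → 𝒵) (K : ℕ → Ω → Fin n → Fin m) (xstar : Param d) (η : ℝ) (t : ℕ)
    (v : Fin n) (B : ℝ) : Prop :=
  Integrable
    (fun ω => testRisk μ ℓ (average ℓ P η (fun v i => Z v i ω) (fun s => K s ω) t v)) Pr ∧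
  (∫ ω, testRisk μ ℓ (average ℓ P η (fun v i => Z v i ω) (fun s => K s ω) t v) ∂Pr)
    - testRisk μ ℓ xstar ≤ B

/-! ### Choices of the step size parameter and of the stopping time -/

/-- The logarithmic term `log((t+1)√n)`. -/
def logTerm (n t : ℕ) : ℝ := Real.log (((t : ℝ) + 1) * √(n : ℝ))

/-- The choice `ρ⋆` of centralised SGD, with a free constant `c`. -/
def rhoCentral (L G c : ℝ) (t : ℕ) : ℝ := G / (L * c * √(t : ℝ))

/-- First-order terms in `ρ` of the optimisation error bound, with `1 / (β + 1 / ρ)` replaced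
by `ρ`; here `γ` is the spectral gap. -/
def optObjective (L G σ κ γ : ℝ) (n t : ℕ) (ρ : ℝ) : ℝ :=
  ρ / 2 * σ ^ 2 + G ^ 2 / (2 * t * ρ) + 3 * L * κ * ρ * (logTerm n t / γ)

/-- First-order terms in `ρ` of the test error bound, with `1 / (β + 1 / ρ)` replaced by `ρ`. -/
def testObjective (L G σ κ γ : ℝ) (n m t : ℕ) (ρ : ℝ) : ℝ :=
  optObjective L G σ κ γ n t ρ + ρ * L ^ 2 / ((n : ℝ) * m) * ((t : ℝ) + 1)

/-- The choice `ρ⋆_Opt`. -/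
def rhoOpt (L G σ κ γ : ℝ) (n t : ℕ) : ℝ :=
  G / √(t : ℝ) * (1 / √(6 * L * κ * (logTerm n t / γ) + σ ^ 2))

/-- The choice `ρ⋆_Test`. -/
def rhoTest (L G σ κ γ : ℝ) (n m t : ℕ) : ℝ :=
  G / √(t : ℝ) * (1 / √(6 * L * κ * (logTerm n t / γ) + σ ^ 2
    + 2 * L ^ 2 * ((t : ℝ) + 1) / ((n : ℝ) * m)))

/-- `a` is the unique minimiser of `f` over the positive reals. -/
def IsUniquePosMin (f : ℝ → ℝ) (a : ℝ) : Prop :=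
  0 < a ∧ ∀ x, 0 < x → (IsMinOn f (Set.Ioi 0) x ↔ x = a)

/-- Leading terms, as a function of the (real) time, of the test error bound for `ρ⋆`, up to
logarithmic terms and a common factor. -/
def centralTimeObjective (L κ γ : ℝ) (n m : ℕ) (τ : ℝ) : ℝ :=
  3 * κ / (γ * √τ) + 2 * L / ((n : ℝ) * m) * √τ

/-- Leading terms of the test error bound for `ρ⋆_Opt`, up to a common factor, as a function of
`τ`, the ratio of the time and the logarithmic term. -/
def optTimeObjective (L κ γ : ℝ) (n m : ℕ) (τ : ℝ) : ℝ :=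
  √(6 * L * κ / (τ * γ)) + 2 * L ^ 2 / ((n : ℝ) * m) * √(τ * γ / (6 * L * κ))

/-- The time scale `n m / γ`. -/
def timeScale (γ : ℝ) (n m : ℕ) : ℝ := (n : ℝ) * m / γ

end DistSGD

end

/-!
Distributed SGD with step size `η = 1 / (β + 1 / ρ)` has test error at most a constant times
`1 / t + 1 / (ρ t) + ρ Λ / γ + ρ t / (n m)`, where `Λ = log ((t + 1) √n)`, `γ` is the spectral gap,
and the constant depends on `L`, `β` and `G` only (`testErrorLE_of_stepSize`, `error_terms_le`).
The rates for the three choices of `ρ` follow by insertion; their constants depend on `σ` and `κ`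
through `ρ`.

The test error is the sum of `E (r - R)` at the output, the optimisation error `E (R - R(X⋆))`, and
`E R(X⋆) - r(x⋆)`, which is at most `E R(x⋆) - r(x⋆) = 0`.

*Generalisation.* For a convex `β`-smooth loss a gradient step with `η ≤ 2 / β` does not expand
distances, by co-coercivity of the gradient (`norm_gradient_step_sub_le`). Hence replacing one data
point changes the iterates by at most `2 η L` at each use of that point. As a node uses one point per
step and rows of `P` sum to one, the changes, summed over all `n m` points, are at most `2 η L s`
after `s` steps, for every index sequence (`sum_norm_iterate_update_sub_le`). Resampling a data
point turns this into `E (r - R) ≤ 2 η L² t / (n m)` (`integral_testRisk_le_of_stable`).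

*Optimisation.* The network average performs SGD with the average of the gradients taken at the
nodes. The regret bound and convexity reduce the optimisation error to `G² / (2 η t)`, terms of order
`η L²`, multiples of the distance of the nodes from the network average, and a noise term
(`empRisk_average_sub_le`) whose expectation vanishes, because indices are uniform and independent of
the past (`integral_gradNoise`). Gradients are bounded by `L` along every path, so this bound serves
for the second moments as well.

*Consensus.* A node differs from the network average by `η` times a sum of gradients with weights
`P ^ k v w - 1 / n`. For normal `P` the operator norm of `P - J`, with `J` the averaging matrix, is
its spectral radius, and the eigenvalues of `P - J` are those of `P` with one `1` replaced by `0`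
(`charpoly_sub_avgMatrix`). So the `ℓ¹` norm of these weights is at most `√n σ₂(P) ^ k`, and also at
most `2`; summing over `k` gives a bound of order `Λ / γ` (`sum_sum_abs_pow_sub_le`).
-/

namespace DistSGD

/-! ### Convex functions with Lipschitz gradient -/

section SmoothConvex

variable {E : Type*} [NormedAddCommGroup E] [InnerProductSpace ℝ E] [CompleteSpace E]

theorem hasDerivAt_comp_line {f : E → ℝ} (hf : Differentiable ℝ f) (x v : E) (t : ℝ) :
    HasDerivAt (fun s : ℝ => f (x + s • v)) (inner ℝ (gradient f (x + t • v)) v) t := by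
  have h1 : HasDerivAt (fun s : ℝ => x + s • v) v t := by
    simpa using ((hasDerivAt_id t).smul_const v).const_add x
  have h2 := (hf (x + t • v)).hasFDerivAt.comp_hasDerivAt t h1
  rw [inner_gradient_left]
  exact h2

/-- A differentiable convex function lies above its tangents. -/
theorem add_inner_gradient_le {f : E → ℝ} (hf : Differentiable ℝ f)
    (hc : ConvexOn ℝ Set.univ f) (x y : E) : f x + inner ℝ (gradient f x) (y - x) ≤ f y := by
  have hc' : ConvexOn ℝ Set.univ (fun s : ℝ => f (x + s • (y - x))) := by
    refine ⟨convex_univ, fun a _ b _ p q hp hq hpq => ?_⟩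
    have := hc.2 (Set.mem_univ (x + a • (y - x))) (Set.mem_univ (x + b • (y - x))) hp hq hpq
    refine le_trans (le_of_eq ?_) this
    obtain rfl : q = 1 - p := by linarith
    change f (x + (p * a + (1 - p) * b) • (y - x)) = f _
    congr 1
    module
  have hd := hasDerivAt_comp_line hf x (y - x) 0
  have := hc'.le_slope_of_hasDerivAt (Set.mem_univ 0) (Set.mem_univ 1) one_pos hd
  simp only [slope, zero_smul, add_zero, sub_zero, one_smul, add_sub_cancel, inv_one,
    vsub_eq_sub, smul_eq_mul, one_mul] at this
  linarith

/-- The descent lemma: a function with `β`-Lipschitz gradient lies below its tangent paraboloids. -/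
theorem le_add_inner_gradient_add_sq {f : E → ℝ} {β : ℝ} (hf : Differentiable ℝ f)
    (hs : ∀ x y, ‖gradient f x - gradient f y‖ ≤ β * ‖x - y‖) (x v : E) :
    f (x + v) ≤ f x + inner ℝ (gradient f x) v + β / 2 * ‖v‖ ^ 2 := by
  have hd : ∀ t : ℝ, HasDerivAt
      (fun s : ℝ => f (x + s • v) - s * inner ℝ (gradient f x) v - β / 2 * ‖v‖ ^ 2 * s ^ 2)
      (inner ℝ (gradient f (x + t • v)) v - 1 * inner ℝ (gradient f x) v
        - β / 2 * ‖v‖ ^ 2 * (2 * t)) t := by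
    intro t
    have h3 : HasDerivAt (fun s : ℝ => β / 2 * ‖v‖ ^ 2 * s ^ 2) (β / 2 * ‖v‖ ^ 2 * (2 * t)) t := by
      simpa using (hasDerivAt_pow 2 t).const_mul (β / 2 * ‖v‖ ^ 2)
    exact ((hasDerivAt_comp_line hf x v t).sub ((hasDerivAt_id t).mul_const _)).sub h3
  have hanti := antitoneOn_of_deriv_nonpos (convex_Icc (0 : ℝ) 1)
    (fun t _ => (hd t).continuousAt.continuousWithinAt)
    (fun t _ => (hd t).differentiableAt.differentiableWithinAt) (by
      intro t ht
      rw [interior_Icc] at ht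
      rw [(hd t).deriv, one_mul, ← inner_sub_left]
      have h1 := real_inner_le_norm (gradient f (x + t • v) - gradient f x) v
      have h2 := hs (x + t • v) x
      rw [add_sub_cancel_left, norm_smul, Real.norm_of_nonneg ht.1.le] at h2
      nlinarith [mul_le_mul_of_nonneg_right h2 (norm_nonneg v)])
  have := hanti (Set.left_mem_Icc.2 zero_le_one) (Set.right_mem_Icc.2 zero_le_one) zero_le_one
  simp only [one_smul, one_mul, one_pow, mul_one, zero_smul, add_zero, zero_mul, sub_zero,
    ne_eq, OfNat.ofNat_ne_zero, not_false_eq_true, zero_pow, mul_zero] at this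
  linarith

/-- Half of the co-coercivity inequality: subtracting a linear term makes `x` a global minimiser,
and one gradient step from `y` cannot go below the minimum. -/
theorem sq_norm_gradient_sub_le {f : E → ℝ} {β : ℝ} (hβ : 0 < β) (hf : Differentiable ℝ f)
    (hc : ConvexOn ℝ Set.univ f) (hs : ∀ x y, ‖gradient f x - gradient f y‖ ≤ β * ‖x - y‖)
    (x y : E) :
    1 / (2 * β) * ‖gradient f x - gradient f y‖ ^ 2
      ≤ f y - f x - inner ℝ (gradient f x) (y - x) := by
  set g := gradient f y - gradient f x with hg
  have h1 := le_add_inner_gradient_add_sq hf hs y (-(1 / β) • g)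
  have h2 := add_inner_gradient_le hf hc x (y + -(1 / β) • g)
  have h3 : inner ℝ (gradient f x) (y + -(1 / β) • g - x)
      = inner ℝ (gradient f x) (y - x) - 1 / β * inner ℝ (gradient f x) g := by
    rw [show y + -(1 / β) • g - x = (y - x) + -(1 / β) • g by abel, inner_add_right,
      inner_smul_right]
    ring
  have h4 : ‖g‖ ^ 2 = inner ℝ (gradient f y) g - inner ℝ (gradient f x) g := by
    rw [← inner_sub_left, ← hg, real_inner_self_eq_norm_sq]
  rw [inner_smul_right, norm_smul, mul_pow, Real.norm_eq_abs, sq_abs] at h1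
  have h5 : β / 2 * ((-(1 / β)) ^ 2 * ‖g‖ ^ 2) = 1 / (2 * β) * ‖g‖ ^ 2 := by
    field_simp
  have h6 : 1 / β * ‖g‖ ^ 2 = 2 * (1 / (2 * β) * ‖g‖ ^ 2) := by field_simp
  have h7 : 1 / β * ‖g‖ ^ 2
      = 1 / β * inner ℝ (gradient f y) g - 1 / β * inner ℝ (gradient f x) g := by
    rw [h4]; ring
  rw [norm_sub_rev, ← hg]
  linarith

/-- A gradient step with step size at most `2 / β` on a convex `β`-smooth function does not
increase distances. -/
theorem norm_gradient_step_sub_le {f : E → ℝ} {β η : ℝ} (hβ : 0 < β) (hη : 0 ≤ η)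
    (hηβ : η * β ≤ 2) (hf : Differentiable ℝ f) (hc : ConvexOn ℝ Set.univ f)
    (hs : ∀ x y, ‖gradient f x - gradient f y‖ ≤ β * ‖x - y‖) (x y : E) :
    ‖(x - η • gradient f x) - (y - η • gradient f y)‖ ≤ ‖x - y‖ := by
  set g := gradient f x - gradient f y with hg
  have h1 := sq_norm_gradient_sub_le hβ hf hc hs x y
  have h2 := sq_norm_gradient_sub_le hβ hf hc hs y x
  have h4 : inner ℝ g (x - y)
      = - inner ℝ (gradient f x) (y - x) - inner ℝ (gradient f y) (x - y) := by
    rw [hg, inner_sub_left, ← neg_sub y x, inner_neg_right]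
  have hco : ‖g‖ ^ 2 ≤ β * inner ℝ g (x - y) := by
    rw [norm_sub_rev] at h2
    have : 1 / β * ‖g‖ ^ 2 ≤ inner ℝ g (x - y) := by
      have : 1 / β * ‖g‖ ^ 2 = 2 * (1 / (2 * β) * ‖g‖ ^ 2) := by field_simp
      linarith
    rw [one_div, inv_mul_le_iff₀ hβ] at this
    exact this
  refine le_of_sq_le_sq ?_ (norm_nonneg _)
  have h5 : (x - η • gradient f x) - (y - η • gradient f y) = (x - y) - η • g := by
    rw [hg, smul_sub]; abel
  rw [h5, norm_sub_sq_real, inner_smul_right, norm_smul, mul_pow, Real.norm_eq_abs, sq_abs,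
    real_inner_comm]
  have h6 : 0 ≤ inner ℝ g (x - y) := by
    by_contra! h
    nlinarith [sq_nonneg ‖g‖]
  have h7 : η ^ 2 * ‖g‖ ^ 2 ≤ η ^ 2 * (β * inner ℝ g (x - y)) :=
    mul_le_mul_of_nonneg_left hco (sq_nonneg η)
  nlinarith [mul_le_mul_of_nonneg_right hηβ (mul_nonneg hη h6)]

theorem norm_gradient_le {f : E → ℝ} {L : ℝ} (hL : 0 ≤ L)
    (hl : ∀ x y, |f x - f y| ≤ L * ‖x - y‖) (x : E) : ‖gradient f x‖ ≤ L := by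
  rw [gradient, LinearIsometryEquiv.norm_map]
  exact norm_fderiv_le_of_lip' ℝ hL (Filter.Eventually.of_forall fun y => hl y x)

end SmoothConvex

/-! ### Mixing of the communication matrix -/

section SpectralGap

/-- The matrix of averaging over all nodes: every entry is `1 / n`. -/
noncomputable def avgMatrix (𝕜 : Type*) [RCLike 𝕜] (n : ℕ) : Matrix (Fin n) (Fin n) 𝕜 :=
  Matrix.of fun _ _ => 1 / (n : 𝕜)

variable {n : ℕ}

theorem mul_avgMatrix {P : Matrix (Fin n) (Fin n) ℝ} (hP : P ∈ doublyStochastic ℝ (Fin n)) :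
    P * avgMatrix ℝ n = avgMatrix ℝ n := by
  ext v w
  simp only [Matrix.mul_apply, avgMatrix, Matrix.of_apply, ← Finset.sum_mul,
    sum_row_of_mem_doublyStochastic hP, one_mul]

theorem avgMatrix_mul {P : Matrix (Fin n) (Fin n) ℝ} (hP : P ∈ doublyStochastic ℝ (Fin n)) :
    avgMatrix ℝ n * P = avgMatrix ℝ n := by
  ext v w
  simp only [Matrix.mul_apply, avgMatrix, Matrix.of_apply, ← Finset.mul_sum,
    sum_col_of_mem_doublyStochastic hP, mul_one]

theorem avgMatrix_mem_doublyStochastic (hn : 0 < n) :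
    avgMatrix ℝ n ∈ doublyStochastic ℝ (Fin n) := by
  have : (n : ℝ) ≠ 0 := by positivity
  rw [mem_doublyStochastic_iff_sum]
  refine ⟨fun v w => ?_, fun v => ?_, fun w => ?_⟩ <;> simp [avgMatrix, this]

theorem pow_sub_avgMatrix (hn : 0 < n) {P : Matrix (Fin n) (Fin n) ℝ}
    (hP : P ∈ doublyStochastic ℝ (Fin n)) (k : ℕ) :
    (P - avgMatrix ℝ n) ^ (k + 1) = P ^ (k + 1) - avgMatrix ℝ n := by
  induction k with
  | zero => simp
  | succ k ih =>
    rw [pow_succ, ih, sub_mul, mul_sub, mul_sub, mul_avgMatrix (pow_mem hP _), avgMatrix_mul hP,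
      mul_avgMatrix (avgMatrix_mem_doublyStochastic hn), sub_self, sub_zero, ← pow_succ]

theorem det_smul_one_add_avgMatrix (hn : 0 < n) (z : ℂ) :
    (z • (1 : Matrix (Fin n) (Fin n) ℂ) + avgMatrix ℂ n).det = z ^ (n - 1) * (z + 1) := by
  have h : avgMatrix ℂ n
      = -Matrix.vecMulVec (fun _ : Fin n => -(1 / (n : ℂ))) (fun _ : Fin n => (1 : ℂ)) := by
    ext v w; simp [avgMatrix, Matrix.vecMulVec_apply]
  have h0 : (n : ℂ) ≠ 0 := by exact_mod_cast hn.ne'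
  have h2 := Matrix.eval_charpoly
    (Matrix.vecMulVec (fun _ : Fin n => -(1 / (n : ℂ))) (fun _ : Fin n => (1 : ℂ))) z
  rw [Matrix.charpoly_vecMulVec] at h2
  have hs : z • (1 : Matrix (Fin n) (Fin n) ℂ) = Matrix.scalar (Fin n) z := by
    ext v w; simp [Matrix.diagonal_apply, Matrix.one_apply]
  rw [h, ← sub_eq_add_neg, hs, ← h2]
  obtain ⟨n, rfl⟩ := Nat.exists_eq_succ_of_ne_zero hn.ne'
  simp [dotProduct]
  field_simp
  ring

/-- Subtracting the averaging matrix from a doubly stochastic matrix replaces one eigenvalue `1`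
by `0` and keeps all others. The identity comes from the factorisation
`(z - 1) (z - (P - J)) = (z - P) ((z - 1) + J)`, where `J` is the averaging matrix. -/
theorem charpoly_sub_avgMatrix (hn : 0 < n) {P : Matrix (Fin n) (Fin n) ℂ}
    (hP : P * avgMatrix ℂ n = avgMatrix ℂ n) :
    (Polynomial.X - Polynomial.C 1) * (P - avgMatrix ℂ n).charpoly
      = (Polynomial.X - Polynomial.C 0) * P.charpoly := by
  refine Polynomial.eq_of_infinite_eval_eq _ _ (Set.Infinite.mono (s := {1}ᶜ) ?_
    (Set.finite_singleton (1 : ℂ)).infinite_compl)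
  intro z hz
  have hz1 : z - 1 ≠ 0 := sub_ne_zero.2 hz
  have hfac : (z - 1) • (Matrix.scalar (Fin n) z - (P - avgMatrix ℂ n))
      = (Matrix.scalar (Fin n) z - P) * ((z - 1) • 1 + avgMatrix ℂ n) := by
    have hs : Matrix.scalar (Fin n) z = z • (1 : Matrix (Fin n) (Fin n) ℂ) := by
      ext v w; simp [Matrix.diagonal_apply, Matrix.one_apply]
    rw [hs, mul_add, sub_mul, sub_mul, hP]
    simp only [smul_mul_assoc, mul_smul_comm, one_mul, mul_one]
    module
  have hdet := congrArg Matrix.det hfac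
  rw [Matrix.det_smul, Matrix.det_mul, det_smul_one_add_avgMatrix hn, ← Matrix.eval_charpoly,
    ← Matrix.eval_charpoly, Fintype.card_fin] at hdet
  obtain ⟨n, rfl⟩ := Nat.exists_eq_succ_of_ne_zero hn.ne'
  simp only [Set.mem_ofPred_eq, Polynomial.eval_mul, Polynomial.eval_sub, Polynomial.eval_X,
    Polynomial.eval_C, sub_zero]
  refine mul_left_cancel₀ (pow_ne_zero n hz1) ?_
  simp only [Nat.succ_eq_add_one, add_tsub_cancel_right, sub_add_cancel] at hdet
  linear_combination hdet

/-- If the second entry of the decreasingly sorted list is below `1`, the entry `1` comes first,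
so the second entry bounds all others. -/
theorem le_getD_sort_cons {s : Multiset ℝ}
    (h : ((1 ::ₘ s).sort (· ≥ ·)).getD 1 0 < 1) {a : ℝ} (ha : a ∈ s) :
    a ≤ ((1 ::ₘ s).sort (· ≥ ·)).getD 1 0 := by
  set l := (1 ::ₘ s).sort (· ≥ ·) with hl
  have hsort : l.Pairwise (· ≥ ·) := Multiset.pairwise_sort _ _
  have hcoe : (l : Multiset ℝ) = 1 ::ₘ s := Multiset.sort_eq _ _
  clear_value l
  match l, hsort, hcoe, h with
  | [], _, hcoe, _ => simp at hcoe
  | [x], _, hcoe, _ =>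
    have := congrArg Multiset.card hcoe
    simp at this
    simp [this] at ha
  | x :: y :: l, hsort, hcoe, h =>
    simp only [List.getD_cons_succ, List.getD_cons_zero] at h ⊢
    have htail : ∀ b ∈ y :: l, b ≤ y := by
      intro b hb
      rcases List.mem_cons.1 hb with rfl | hb
      · exact le_rfl
      · exact (List.pairwise_cons.1 (List.pairwise_cons.1 hsort).2).1 b hb
    have hx : x = 1 := by
      have h1 : (1 : ℝ) ∈ ((x :: y :: l : List ℝ) : Multiset ℝ) := by
        rw [hcoe]; exact Multiset.mem_cons_self _ _
      rcases List.mem_cons.1 (Multiset.mem_coe.1 h1) with h1 | h1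
      · exact h1.symm
      · linarith [htail 1 h1]
    rw [hx, ← Multiset.cons_coe, Multiset.cons_inj_right] at hcoe
    rw [← hcoe] at ha
    exact htail a (Multiset.mem_coe.1 ha)

theorem secondEigenvalue_nonneg (P : Matrix (Fin n) (Fin n) ℝ) : 0 ≤ secondEigenvalue P := by
  unfold secondEigenvalue
  set s := (P.map (algebraMap ℝ ℂ)).charpoly.roots.map (fun a : ℂ => ‖a‖) with hs
  by_cases h : 1 < (s.sort (· ≥ ·)).length
  · rw [List.getD_eq_getElem _ _ h]
    have h1 := List.getElem_mem h
    obtain ⟨a, -, ha⟩ := Multiset.mem_map.1 ((Multiset.mem_sort _).1 h1)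
    rw [← ha]
    exact norm_nonneg a
  · rw [List.getD_eq_default _ _ (not_lt.1 h)]

theorem norm_le_secondEigenvalue (hn : 0 < n) {P : Matrix (Fin n) (Fin n) ℝ}
    (hP : P ∈ doublyStochastic ℝ (Fin n)) (hgap : 0 < gap P) {a : ℂ}
    (ha : a ∈ (P.map (algebraMap ℝ ℂ) - avgMatrix ℂ n).charpoly.roots) :
    ‖a‖ ≤ secondEigenvalue P := by
  set Q := P.map (algebraMap ℝ ℂ) with hQ
  have hJ : avgMatrix ℂ n = (avgMatrix ℝ n).map (algebraMap ℝ ℂ) := by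
    ext v w; simp [avgMatrix]
  have hmul : Q * avgMatrix ℂ n = avgMatrix ℂ n := by
    rw [hJ, hQ, ← Matrix.map_mul, mul_avgMatrix hP]
  have hroots := congrArg Polynomial.roots (charpoly_sub_avgMatrix hn hmul)
  rw [Polynomial.roots_mul (mul_ne_zero (Polynomial.X_sub_C_ne_zero _)
      (Matrix.charpoly_monic _).ne_zero),
    Polynomial.roots_mul (mul_ne_zero (Polynomial.X_sub_C_ne_zero _)
      (Matrix.charpoly_monic _).ne_zero), Polynomial.roots_X_sub_C, Polynomial.roots_X_sub_C,
    Multiset.singleton_add, Multiset.singleton_add] at hroots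
  have h1 : (1 : ℂ) ∈ Q.charpoly.roots := by
    have : (1 : ℂ) ∈ 0 ::ₘ Q.charpoly.roots := by
      rw [← hroots]; exact Multiset.mem_cons_self _ _
    simpa using this
  obtain ⟨s, hs⟩ := Multiset.exists_cons_of_mem h1
  rw [hs, Multiset.cons_swap, Multiset.cons_inj_right] at hroots
  have hsec : secondEigenvalue P
      = ((1 ::ₘ s.map (fun a : ℂ => ‖a‖)).sort (· ≥ ·)).getD 1 0 := by
    rw [secondEigenvalue, ← hQ, hs, Multiset.map_cons, norm_one]
  rw [hroots, Multiset.mem_cons] at ha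
  rcases ha with rfl | ha
  · rw [norm_zero]; exact secondEigenvalue_nonneg P
  · rw [hsec]
    refine le_getD_sort_cons ?_ (Multiset.mem_map_of_mem _ ha)
    rw [← hsec]
    unfold gap at hgap
    linarith

open scoped Matrix.Norms.L2Operator in
/-- For a normal matrix the operator norm is the spectral radius, so away from the constants a
communication matrix contracts by the factor `σ₂(P)`. -/
theorem l2_opNorm_sub_avgMatrix_le (hn : 0 < n) {graph : SimpleGraph (Fin n)}
    {P : Matrix (Fin n) (Fin n) ℝ} (hP : IsCommMatrix graph P) :
    ‖P.map (algebraMap ℝ ℂ) - avgMatrix ℂ n‖ ≤ secondEigenvalue P := by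
  have hds := hP.doublyStochastic
  set N := P.map (algebraMap ℝ ℂ) - avgMatrix ℂ n with hN
  have hNr : N = (P - avgMatrix ℝ n).map (algebraMap ℝ ℂ) := by
    ext v w; simp [hN, avgMatrix]
  have hstar : star N = (P - avgMatrix ℝ n)ᵀ.map (algebraMap ℝ ℂ) := by
    ext v w; simp [hNr, Matrix.star_apply]
  have hJt : (avgMatrix ℝ n)ᵀ = avgMatrix ℝ n := by ext v w; simp [avgMatrix]
  have hT := transpose_mem_doublyStochastic_iff.2 hds
  have hnormal : IsStarNormal N := by
    refine ⟨?_⟩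
    rw [Commute, SemiconjBy, hstar, hNr, ← Matrix.map_mul, ← Matrix.map_mul]
    congr 1
    rw [Matrix.transpose_sub, hJt]
    simp only [sub_mul, mul_sub, mul_avgMatrix hds, avgMatrix_mul hds, mul_avgMatrix hT,
      avgMatrix_mul hT, hP.normal]
  have h := IsStarNormal.spectralRadius_eq_nnnorm N
  have h2 : spectralRadius ℂ N ≤ ((secondEigenvalue P).toNNReal : ENNReal) := by
    refine iSup₂_le fun a ha => ?_
    rw [Matrix.mem_spectrum_iff_isRoot_charpoly] at ha
    have := norm_le_secondEigenvalue hn hds hP.gap_pos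
      ((Polynomial.mem_roots (Matrix.charpoly_monic _).ne_zero).2 ha)
    rw [ENNReal.coe_le_coe, ← NNReal.coe_le_coe, Real.coe_toNNReal _ (secondEigenvalue_nonneg P)]
    exact this
  rw [h, ENNReal.coe_le_coe, ← NNReal.coe_le_coe,
    Real.coe_toNNReal _ (secondEigenvalue_nonneg P)] at h2
  exact h2

open scoped Matrix.Norms.L2Operator in
/-- The `ℓ¹` norm of a row, by the Cauchy-Schwarz inequality from its `ℓ²` norm. -/
theorem sum_norm_row_le (M : Matrix (Fin n) (Fin n) ℂ) (v : Fin n) :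
    ∑ w, ‖M v w‖ ≤ √n * ‖M‖ := by
  have h := Matrix.l2_opNorm_mulVec Mᴴ (PiLp.single 2 v 1)
  rw [Matrix.l2_opNorm_conjTranspose, PiLp.norm_single, norm_one, mul_one,
    PiLp.ofLp_single, Matrix.mulVec_single_one, EuclideanSpace.norm_eq] at h
  have hrow : ∀ w, ‖((EuclideanSpace.equiv (Fin n) ℂ).symm (Mᴴ.col v)).ofLp w‖ = ‖M v w‖ := by
    intro w
    change ‖star (M v w)‖ = _
    rw [norm_star]
  simp only [hrow] at h
  have hcs := sq_sum_le_card_mul_sum_sq (s := Finset.univ) (f := fun w => ‖M v w‖)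
  rw [Finset.card_univ, Fintype.card_fin] at hcs
  calc ∑ w, ‖M v w‖ ≤ √(n * ∑ w, ‖M v w‖ ^ 2) := Real.le_sqrt_of_sq_le hcs
    _ = √n * √(∑ w, ‖M v w‖ ^ 2) := Real.sqrt_mul (Nat.cast_nonneg n) _
    _ ≤ √n * ‖M‖ := by gcongr

open scoped Matrix.Norms.L2Operator in
theorem sum_abs_pow_sub_le (hn : 0 < n) {graph : SimpleGraph (Fin n)}
    {P : Matrix (Fin n) (Fin n) ℝ} (hP : IsCommMatrix graph P) (k : ℕ) (v : Fin n) :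
    ∑ w, |(P ^ (k + 1)) v w - 1 / n| ≤ √n * secondEigenvalue P ^ (k + 1) := by
  set N := P.map (algebraMap ℝ ℂ) - avgMatrix ℂ n with hN
  have hNr : N = (P - avgMatrix ℝ n).map (algebraMap ℝ ℂ) := by
    ext v w; simp [hN, avgMatrix]
  have hpow : N ^ (k + 1) = (P ^ (k + 1) - avgMatrix ℝ n).map (algebraMap ℝ ℂ) := by
    rw [hNr, ← Matrix.map_pow, pow_sub_avgMatrix hn hP.doublyStochastic]
  have h1 := sum_norm_row_le (N ^ (k + 1)) v
  have h2 : ‖N ^ (k + 1)‖ ≤ secondEigenvalue P ^ (k + 1) :=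
    (norm_pow_le' N k.succ_pos).trans
      (pow_le_pow_left₀ (norm_nonneg _) (l2_opNorm_sub_avgMatrix_le hn hP) _)
  have h3 : ∀ w, ‖(N ^ (k + 1)) v w‖ = |(P ^ (k + 1)) v w - 1 / n| := by
    intro w
    rw [hpow, Matrix.map_apply, norm_algebraMap', Real.norm_eq_abs]
    simp [avgMatrix]
  simp only [h3] at h1
  exact h1.trans (by gcongr)

theorem sum_abs_pow_sub_le_two (hn : 0 < n) {P : Matrix (Fin n) (Fin n) ℝ}
    (hP : P ∈ doublyStochastic ℝ (Fin n)) (k : ℕ) (v : Fin n) :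
    ∑ w, |(P ^ k) v w - 1 / n| ≤ 2 := by
  have hn0 : (n : ℝ) ≠ 0 := by positivity
  have hk := pow_mem hP k
  calc ∑ w, |(P ^ k) v w - 1 / n| ≤ ∑ w, ((P ^ k) v w + 1 / n) := by
        refine Finset.sum_le_sum fun w _ => (abs_sub _ _).trans (le_of_eq ?_)
        rw [abs_of_nonneg (nonneg_of_mem_doublyStochastic hk),
          abs_of_nonneg (by positivity : (0 : ℝ) ≤ 1 / n)]
    _ = 2 := by
        rw [Finset.sum_add_distrib, sum_row_of_mem_doublyStochastic hk]
        simp [hn0]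
        norm_num

theorem gap_le_one (P : Matrix (Fin n) (Fin n) ℝ) : gap P ≤ 1 := by
  have := secondEigenvalue_nonneg P
  unfold gap; linarith

theorem half_le_logTerm (hn : 0 < n) {t : ℕ} (ht : 0 < t) : 1 / 2 ≤ logTerm n t := by
  have h1 : (1 : ℝ) ≤ √n := Real.one_le_sqrt.2 (by exact_mod_cast hn)
  have h2 : (1 : ℝ) ≤ t := by exact_mod_cast ht
  have h3 : Real.log 2 ≤ logTerm n t := Real.log_le_log two_pos (by nlinarith)
  linarith [Real.log_two_gt_d9]

/-- The mixing bound: up to time `Λ / γ` each row of `P ^ k` is at `ℓ¹` distance at most `2` from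
the uniform distribution, and afterwards at distance at most `1 / (t + 1)`. -/
theorem sum_sum_abs_pow_sub_le (hn : 0 < n) {graph : SimpleGraph (Fin n)}
    {P : Matrix (Fin n) (Fin n) ℝ} (hP : IsCommMatrix graph P) {s t : ℕ} (hst : s ≤ t)
    (ht : 0 < t) (v : Fin n) :
    ∑ k ∈ Finset.range s, ∑ w, |(P ^ (k + 1)) v w - 1 / n| ≤ 8 * (logTerm n t / gap P) := by
  have hγ := hP.gap_pos
  have hγ1 := gap_le_one P
  have hΛ := half_le_logTerm hn ht
  set T := logTerm n t / gap P with hT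
  have hT1 : 1 / 2 ≤ T := by
    rw [hT, le_div_iff₀ hγ]; linarith
  have hsqrt : 0 < √(n : ℝ) := Real.sqrt_pos.2 (by exact_mod_cast hn)
  -- After time `Λ / γ` the bound `√n (1 - γ) ^ k ≤ √n exp (-γ k)` is below `√n exp (-Λ)`.
  have hterm : ∀ k, ∑ w, |(P ^ (k + 1)) v w - 1 / n|
      ≤ (if k < ⌈T⌉₊ then 2 else 0) + 1 / ((t : ℝ) + 1) := by
    intro k
    split_ifs with hk
    · have : (0 : ℝ) ≤ 1 / ((t : ℝ) + 1) := by positivity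
      linarith [sum_abs_pow_sub_le_two hn hP.doublyStochastic (k + 1) v]
    · refine (sum_abs_pow_sub_le hn hP k v).trans ?_
      have hTk : T ≤ k := Nat.ceil_le.1 (not_lt.1 hk)
      have h1 : secondEigenvalue P ≤ Real.exp (-gap P) := by
        have := Real.add_one_le_exp (-gap P)
        unfold gap at this ⊢
        linarith
      have h2 : secondEigenvalue P ^ (k + 1) ≤ Real.exp (-logTerm n t) := by
        refine (pow_le_pow_left₀ (secondEigenvalue_nonneg P) h1 _).trans ?_
        rw [← Real.exp_nat_mul]
        refine Real.exp_le_exp.2 ?_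
        have h3 : logTerm n t ≤ (k + 1 : ℕ) * gap P := by
          rw [← div_le_iff₀ hγ]; push_cast; linarith
        linarith
      have h4 : Real.exp (-logTerm n t) = 1 / (((t : ℝ) + 1) * √n) := by
        rw [Real.exp_neg, logTerm, Real.exp_log (by positivity), one_div]
      calc √n * secondEigenvalue P ^ (k + 1) ≤ √n * (1 / (((t : ℝ) + 1) * √n)) := by
            rw [← h4]; gcongr
        _ = 0 + 1 / ((t : ℝ) + 1) := by field_simp; ring
  have hsum1 : ∑ k ∈ Finset.range s, (if k < ⌈T⌉₊ then (2 : ℝ) else 0) ≤ 2 * ⌈T⌉₊ := by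
    rw [← Finset.sum_filter, Finset.sum_const, nsmul_eq_mul, mul_comm]
    have : (Finset.filter (fun k => k < ⌈T⌉₊) (Finset.range s)).card ≤ ⌈T⌉₊ := by
      refine (Finset.card_le_card (t := Finset.range ⌈T⌉₊) ?_).trans (Finset.card_range _).le
      intro k hk
      exact Finset.mem_range.2 (Finset.mem_filter.1 hk).2
    gcongr
  have hsum2 : ∑ _k ∈ Finset.range s, 1 / ((t : ℝ) + 1) ≤ 1 := by
    rw [Finset.sum_const, Finset.card_range, nsmul_eq_mul, mul_one_div,
      div_le_one (by positivity)]
    have : (s : ℝ) ≤ t := by exact_mod_cast hst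
    linarith
  have hceil : (⌈T⌉₊ : ℝ) < T + 1 := Nat.ceil_lt_add_one (by linarith)
  calc _ ≤ ∑ k ∈ Finset.range s, ((if k < ⌈T⌉₊ then (2 : ℝ) else 0) + 1 / ((t : ℝ) + 1)) :=
        Finset.sum_le_sum fun k _ => hterm k
    _ ≤ 2 * ⌈T⌉₊ + 1 := by rw [Finset.sum_add_distrib]; linarith
    _ ≤ 8 * T := by linarith

end SpectralGap

/-! ### Distributed SGD along a fixed path -/

section Pathwise

variable {d n m : ℕ} {𝒵 : Type*} {ℓ : Param d → 𝒵 → ℝ} {L β η : ℝ} {P : Matrix (Fin n) (Fin n) ℝ}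

/-- The network average `(1 / n) ∑_v X_v` of the vectors of the nodes. -/
noncomputable def netAverage (ℓ : Param d → 𝒵 → ℝ) (P : Matrix (Fin n) (Fin n) ℝ) (η : ℝ)
    (D : Fin n → Fin m → 𝒵) (K : ℕ → Fin n → Fin m) (s : ℕ) : Param d :=
  (1 / (n : ℝ)) • ∑ v, iterate ℓ P η D K s v

/-- The stochastic gradient used by node `w` at time `s`. -/
noncomputable def stochGrad (ℓ : Param d → 𝒵 → ℝ) (P : Matrix (Fin n) (Fin n) ℝ) (η : ℝ)
    (D : Fin n → Fin m → 𝒵) (K : ℕ → Fin n → Fin m) (s : ℕ) (w : Fin n) : Param d :=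
  lossGrad ℓ (iterate ℓ P η D K s w) (D w (K s w))

theorem netAverage_succ (hP : P ∈ doublyStochastic ℝ (Fin n)) (D : Fin n → Fin m → 𝒵)
    (K : ℕ → Fin n → Fin m) (s : ℕ) :
    netAverage ℓ P η D K (s + 1)
      = netAverage ℓ P η D K s - η • (1 / (n : ℝ)) • ∑ w, stochGrad ℓ P η D K s w := by
  have h : ∑ v, iterate ℓ P η D K (s + 1) v
      = ∑ w, (iterate ℓ P η D K s w - η • stochGrad ℓ P η D K s w) := by
    simp only [iterate]
    rw [Finset.sum_comm]
    refine Finset.sum_congr rfl fun w _ => ?_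
    rw [← Finset.sum_smul, sum_col_of_mem_doublyStochastic hP, one_smul, stochGrad]
  rw [netAverage, h, Finset.sum_sub_distrib, smul_sub, ← Finset.smul_sum, smul_comm, netAverage]

theorem netAverage_eq (hP : P ∈ doublyStochastic ℝ (Fin n)) (D : Fin n → Fin m → 𝒵)
    (K : ℕ → Fin n → Fin m) (s : ℕ) :
    netAverage ℓ P η D K s
      = -η • ∑ k ∈ Finset.range s, ∑ w, (1 / (n : ℝ)) • stochGrad ℓ P η D K k w := by
  induction s with
  | zero => simp [netAverage, iterate]
  | succ s ih =>
    rw [netAverage_succ hP, ih, Finset.sum_range_succ, smul_add, ← Finset.smul_sum]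
    simp [sub_eq_add_neg]

theorem iterate_eq (D : Fin n → Fin m → 𝒵) (K : ℕ → Fin n → Fin m) (s : ℕ) (v : Fin n) :
    iterate ℓ P η D K s v
      = -η • ∑ k ∈ Finset.range s, ∑ w, (P ^ (s - k)) v w • stochGrad ℓ P η D K k w := by
  induction s generalizing v with
  | zero => simp [iterate]
  | succ s ih =>
    have h : ∀ k ∈ Finset.range s, ∑ u, (P ^ (s + 1 - k)) v u • stochGrad ℓ P η D K k u
        = ∑ w, P v w • ∑ u, (P ^ (s - k)) w u • stochGrad ℓ P η D K k u := by
      intro k hk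
      rw [Nat.succ_sub (Finset.mem_range.1 hk).le, Nat.succ_eq_add_one, pow_succ']
      simp only [Matrix.mul_apply, Finset.sum_smul, Finset.smul_sum, mul_smul]
      rw [Finset.sum_comm]
    rw [Finset.sum_range_succ, Finset.sum_congr rfl h, iterate, Finset.sum_comm, smul_add]
    simp only [smul_sub, Finset.sum_sub_distrib, ← Finset.smul_sum]
    rw [sub_eq_add_neg]
    congr 1
    · rw [Finset.smul_sum]
      refine Finset.sum_congr rfl fun w _ => ?_
      rw [ih w, smul_comm]
    · simp only [Nat.add_sub_cancel_left, pow_one, stochGrad, Finset.smul_sum, neg_smul,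
        Finset.sum_neg_distrib]
      congr 1
      exact Finset.sum_congr rfl fun w _ => smul_comm _ _ _

variable [MeasurableSpace 𝒵] {μ : Measure 𝒵}

theorem IsSmoothLoss.norm_lossGrad_le (hℓ : IsSmoothLoss μ ℓ L β) (hL : 0 ≤ L) (x : Param d)
    (z : 𝒵) : ‖lossGrad ℓ x z‖ ≤ L :=
  norm_gradient_le hL (hℓ.lipschitz z) x

/-- A convex combination of the nodes' vectors is at most the largest bound on their norms. -/
theorem norm_sum_smul_le (hP : P ∈ doublyStochastic ℝ (Fin n)) {x : Fin n → Param d} {b : ℝ}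
    (hx : ∀ w, ‖x w‖ ≤ b) (v : Fin n) : ‖∑ w, P v w • x w‖ ≤ b := by
  calc ‖∑ w, P v w • x w‖ ≤ ∑ w, P v w * b := by
        refine (norm_sum_le _ _).trans (Finset.sum_le_sum fun w _ => ?_)
        rw [norm_smul, Real.norm_of_nonneg (nonneg_of_mem_doublyStochastic hP)]
        exact mul_le_mul_of_nonneg_left (hx w) (nonneg_of_mem_doublyStochastic hP)
    _ = b := by rw [← Finset.sum_mul, sum_row_of_mem_doublyStochastic hP, one_mul]

theorem norm_iterate_le (hℓ : IsSmoothLoss μ ℓ L β) (hL : 0 ≤ L) (hη : 0 ≤ η)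
    (hP : P ∈ doublyStochastic ℝ (Fin n)) (D : Fin n → Fin m → 𝒵) (K : ℕ → Fin n → Fin m)
    (s : ℕ) (v : Fin n) : ‖iterate ℓ P η D K s v‖ ≤ η * L * s := by
  induction s generalizing v with
  | zero => simp [iterate]
  | succ s ih =>
    rw [iterate]
    refine norm_sum_smul_le hP (fun w => ?_) v
    refine (norm_sub_le _ _).trans ?_
    rw [norm_smul, Real.norm_of_nonneg hη]
    have := mul_le_mul_of_nonneg_left
      (hℓ.norm_lossGrad_le hL (iterate ℓ P η D K s w) (D w (K s w))) hη
    push_cast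
    linarith [ih w]

theorem norm_average_le_of_forall {x : ℕ → Param d} {t : ℕ} (ht : 0 < t) {b : ℝ}
    (hx : ∀ s ∈ Finset.Icc 1 t, ‖x s‖ ≤ b) : ‖(1 / (t : ℝ)) • ∑ s ∈ Finset.Icc 1 t, x s‖ ≤ b := by
  have ht0 : (0 : ℝ) < t := by exact_mod_cast ht
  rw [norm_smul, Real.norm_of_nonneg (by positivity), one_div, inv_mul_le_iff₀ ht0]
  refine (norm_sum_le_of_le _ hx).trans (le_of_eq ?_)
  simp

theorem norm_average_le (hℓ : IsSmoothLoss μ ℓ L β) (hL : 0 ≤ L) (hη : 0 ≤ η)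
    (hP : P ∈ doublyStochastic ℝ (Fin n)) (D : Fin n → Fin m → 𝒵) (K : ℕ → Fin n → Fin m)
    {t : ℕ} (ht : 0 < t) (v : Fin n) : ‖average ℓ P η D K t v‖ ≤ η * L * t := by
  refine norm_average_le_of_forall ht fun s hs => (norm_iterate_le hℓ hL hη hP D K s v).trans ?_
  have : (s : ℝ) ≤ t := by exact_mod_cast (Finset.mem_Icc.1 hs).2
  gcongr

/-! ### Consensus -/

/-- Nodes stay close to the network average. The gradients enter with the weights of a power of `P`
at a node and with uniform weights in the average, so mixing of `P` bounds the difference. -/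
theorem norm_iterate_sub_netAverage_le (hn : 0 < n) {graph : SimpleGraph (Fin n)}
    (hP : IsCommMatrix graph P) (hℓ : IsSmoothLoss μ ℓ L β) (hL : 0 ≤ L) (hη : 0 ≤ η)
    (D : Fin n → Fin m → 𝒵) (K : ℕ → Fin n → Fin m) {s t : ℕ} (hst : s ≤ t) (ht : 0 < t)
    (v : Fin n) :
    ‖iterate ℓ P η D K s v - netAverage ℓ P η D K s‖ ≤ 8 * η * L * (logTerm n t / gap P) := by
  rw [iterate_eq, netAverage_eq hP.doublyStochastic, ← smul_sub, norm_smul, norm_neg,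
    Real.norm_of_nonneg hη, ← Finset.sum_sub_distrib]
  have h1 : ‖∑ k ∈ Finset.range s, (∑ w, (P ^ (s - k)) v w • stochGrad ℓ P η D K k w
      - ∑ w, (1 / (n : ℝ)) • stochGrad ℓ P η D K k w)‖
      ≤ ∑ k ∈ Finset.range s, (∑ w, |(P ^ (s - k)) v w - 1 / n|) * L := by
    refine norm_sum_le_of_le _ fun k _ => ?_
    rw [← Finset.sum_sub_distrib, Finset.sum_mul]
    refine norm_sum_le_of_le _ fun w _ => ?_
    rw [← sub_smul, norm_smul, Real.norm_eq_abs]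
    exact mul_le_mul_of_nonneg_left (hℓ.norm_lossGrad_le hL _ _) (abs_nonneg _)
  have h2 : ∑ k ∈ Finset.range s, ∑ w, |(P ^ (s - k)) v w - 1 / n|
      = ∑ k ∈ Finset.range s, ∑ w, |(P ^ (k + 1)) v w - 1 / n| := by
    rw [← Finset.sum_range_reflect]
    refine Finset.sum_congr rfl fun k hk => ?_
    have : s - (s - 1 - k) = k + 1 := by have := Finset.mem_range.1 hk; omega
    rw [this]
  rw [← Finset.sum_mul, h2] at h1
  have h3 := mul_le_mul_of_nonneg_right (sum_sum_abs_pow_sub_le hn hP hst ht v) hL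
  have h4 := mul_le_mul_of_nonneg_left (h1.trans h3) hη
  linarith

/-! ### Optimisation error along a path -/

/-- The mean `(1 / (n m)) ∑_w ∑_i a_{w,i}` over all data points. -/
noncomputable def dataMean (a : Fin n → Fin m → ℝ) : ℝ :=
  (1 / ((n : ℝ) * m)) * ∑ w, ∑ i, a w i

theorem dataMean_mono {a b : Fin n → Fin m → ℝ} (h : ∀ w i, a w i ≤ b w i) :
    dataMean a ≤ dataMean b :=
  mul_le_mul_of_nonneg_left
    (Finset.sum_le_sum fun w _ => Finset.sum_le_sum fun i _ => h w i) (by positivity)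

theorem dataMean_add (a b : Fin n → Fin m → ℝ) :
    dataMean (fun w i => a w i + b w i) = dataMean a + dataMean b := by
  simp only [dataMean, Finset.sum_add_distrib, mul_add]

theorem dataMean_sub (a b : Fin n → Fin m → ℝ) :
    dataMean (fun w i => a w i - b w i) = dataMean a - dataMean b := by
  simp only [dataMean, Finset.sum_sub_distrib, mul_sub]

theorem dataMean_fst (hn : 0 < n) (hm : 0 < m) (a : Fin n → ℝ) :
    dataMean (fun w (_ : Fin m) => a w) = (1 / (n : ℝ)) * ∑ w, a w := by
  have hn0 : (n : ℝ) ≠ 0 := by positivity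
  have hm0 : (m : ℝ) ≠ 0 := by positivity
  simp only [dataMean, Finset.sum_const, Finset.card_univ, Fintype.card_fin, nsmul_eq_mul,
    ← Finset.mul_sum]
  field_simp

theorem dataMean_const (hn : 0 < n) (hm : 0 < m) (c : ℝ) :
    dataMean (fun (_ : Fin n) (_ : Fin m) => c) = c := by
  have hn0 : (n : ℝ) ≠ 0 := by positivity
  rw [dataMean_fst hn hm]
  simp [hn0]

theorem dataMean_smul_sum {ι : Type*} (c : ℝ) (s : Finset ι) (a : ι → Fin n → Fin m → ℝ) :
    dataMean (fun w i => c * ∑ k ∈ s, a k w i) = c * ∑ k ∈ s, dataMean (a k) := by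
  simp only [dataMean, ← Finset.mul_sum]
  rw [mul_left_comm]
  congr 2
  symm
  rw [Finset.sum_comm]
  exact Finset.sum_congr rfl fun w _ => Finset.sum_comm

/-- The deviation of the stochastic gradients from the local full gradients at time `s`, averaged
over the network, in the direction from `y` to the network average. -/
noncomputable def gradNoise (ℓ : Param d → 𝒵 → ℝ) (P : Matrix (Fin n) (Fin n) ℝ) (η : ℝ)
    (D : Fin n → Fin m → 𝒵) (K : ℕ → Fin n → Fin m) (y : Param d) (s : ℕ) : ℝ :=
  dataMean fun w i =>
    inner ℝ (stochGrad ℓ P η D K s w) (netAverage ℓ P η D K s - y)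
      - inner ℝ (lossGrad ℓ (iterate ℓ P η D K s w) (D w i)) (netAverage ℓ P η D K s - y)

/-- The regret bound of gradient descent, applied to the network average: expand
`‖x_{s+1} - y‖²` and telescope. -/
theorem sum_inner_stochGrad_le (hn : 0 < n) (hm : 0 < m)
    (hP : P ∈ doublyStochastic ℝ (Fin n)) (hℓ : IsSmoothLoss μ ℓ L β) (hL : 0 ≤ L) (hη : 0 < η)
    (D : Fin n → Fin m → 𝒵) (K : ℕ → Fin n → Fin m) (y : Param d) (t : ℕ) :
    ∑ s ∈ Finset.range t, dataMean (fun w (_ : Fin m) =>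
        inner ℝ (stochGrad ℓ P η D K s w) (netAverage ℓ P η D K s - y))
      ≤ ‖y‖ ^ 2 / (2 * η) + η * t * L ^ 2 / 2 := by
  suffices h : 2 * η * ∑ s ∈ Finset.range t, dataMean (fun w (_ : Fin m) =>
        inner ℝ (stochGrad ℓ P η D K s w) (netAverage ℓ P η D K s - y))
      ≤ ‖y‖ ^ 2 - ‖netAverage ℓ P η D K t - y‖ ^ 2 + η ^ 2 * L ^ 2 * t by
    have h' : 2 * η * (‖y‖ ^ 2 / (2 * η) + η * t * L ^ 2 / 2)
        = ‖y‖ ^ 2 + η ^ 2 * L ^ 2 * t := by field_simp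
    refine le_of_mul_le_mul_left ?_ (by positivity : 0 < 2 * η)
    rw [h']
    linarith [sq_nonneg ‖netAverage ℓ P η D K t - y‖]
  induction t with
  | zero => simp [netAverage, iterate]
  | succ t ih =>
    set g := (1 / (n : ℝ)) • ∑ w, stochGrad ℓ P η D K t w with hg
    set x := netAverage ℓ P η D K t - y with hx
    have h1 : netAverage ℓ P η D K (t + 1) - y = x - η • g := by
      rw [netAverage_succ hP, hx, hg]; abel
    have h2 : dataMean (fun w (_ : Fin m) => inner ℝ (stochGrad ℓ P η D K t w) x)
        = inner ℝ g x := by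
      rw [dataMean_fst hn hm, hg, inner_smul_left, sum_inner]; simp
    have h3 : ‖g‖ ≤ L := by
      have hn0 : (0 : ℝ) < n := by exact_mod_cast hn
      rw [hg, norm_smul, Real.norm_of_nonneg (by positivity), one_div, inv_mul_le_iff₀ hn0]
      refine (norm_sum_le_of_le _ fun w _ => hℓ.norm_lossGrad_le hL _ _).trans (le_of_eq ?_)
      simp
    have h4 : ‖g‖ ^ 2 ≤ L ^ 2 := pow_le_pow_left₀ (norm_nonneg _) h3 2
    rw [Finset.sum_range_succ, h2, h1, norm_sub_sq_real, inner_smul_right, norm_smul, mul_pow,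
      Real.norm_eq_abs, sq_abs, real_inner_comm]
    have h5 := mul_le_mul_of_nonneg_left h4 (sq_nonneg η)
    push_cast
    rw [mul_add]
    linarith

theorem loss_le_add (hℓ : IsSmoothLoss μ ℓ L β) (z : 𝒵) (x y : Param d) :
    ℓ x z ≤ ℓ y z + L * ‖x - y‖ := by
  have := (abs_le.1 (hℓ.lipschitz z x y)).2
  linarith

/-- The optimisation error of node `v`, before taking expectations: the regret of gradient descent,
the price of the disagreement between nodes, and a noise term. -/
theorem empRisk_average_sub_le (hn : 0 < n) (hm : 0 < m) {graph : SimpleGraph (Fin n)}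
    (hP : IsCommMatrix graph P) (hℓ : IsSmoothLoss μ ℓ L β) (hL : 0 ≤ L) (hη : 0 < η)
    (D : Fin n → Fin m → 𝒵) (K : ℕ → Fin n → Fin m) {t : ℕ} (ht : 0 < t) (v : Fin n)
    (y : Param d) :
    empRisk ℓ D (average ℓ P η D K t v) - empRisk ℓ D y
      ≤ ‖y‖ ^ 2 / (2 * η * t) + 3 / 2 * η * L ^ 2 + 24 * η * L ^ 2 * (logTerm n t / gap P)
        - 1 / (t : ℝ) * ∑ s ∈ Finset.range t, gradNoise ℓ P η D K y s := by
  have ht0 : (0 : ℝ) < t := by exact_mod_cast ht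
  set c := 8 * η * L * (logTerm n t / gap P) with hc
  set x := netAverage ℓ P η D K with hx
  have hcons : ∀ s, s ≤ t → ∀ w, ‖iterate ℓ P η D K s w - x s‖ ≤ c := fun s hs w =>
    norm_iterate_sub_netAverage_le hn hP hℓ hL hη.le D K hs ht w
  have hstep : ∀ s, ‖x (s + 1) - x s‖ ≤ η * L := by
    intro s
    have hn0 : (0 : ℝ) < n := by exact_mod_cast hn
    rw [hx, netAverage_succ hP.doublyStochastic, sub_sub_cancel_left, norm_neg, norm_smul,
      norm_smul, Real.norm_of_nonneg hη.le, Real.norm_of_nonneg (by positivity)]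
    refine mul_le_mul_of_nonneg_left ?_ hη.le
    rw [one_div, inv_mul_le_iff₀ hn0]
    refine (norm_sum_le_of_le _ fun w _ => hℓ.norm_lossGrad_le hL _ _).trans (le_of_eq ?_)
    simp
  -- Convexity passes from the time average to the single times, the Lipschitz property from a node
  -- at time `s + 1` to the network average at time `s`.
  have hA : empRisk ℓ D (average ℓ P η D K t v)
      ≤ 1 / (t : ℝ) * ∑ s ∈ Finset.range t, empRisk ℓ D (x s) + (L * c + η * L ^ 2) := by
    have hz : ∀ z, ℓ (average ℓ P η D K t v) z
        ≤ 1 / (t : ℝ) * ∑ s ∈ Finset.range t, ℓ (x s) z + (L * c + η * L ^ 2) := by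
      intro z
      have hJ := (hℓ.convex z).map_sum_le (t := Finset.Icc 1 t) (w := fun _ => 1 / (t : ℝ))
        (p := fun s => iterate ℓ P η D K s v) (fun _ _ => by positivity)
        (by simp [ht0.ne']) (fun _ _ => Set.mem_univ _)
      rw [← Finset.smul_sum] at hJ
      refine hJ.trans ?_
      have hI : Finset.Icc 1 t = (Finset.range t).image (· + 1) := by
        ext a
        simp only [Finset.mem_Icc, Finset.mem_image, Finset.mem_range]
        exact ⟨fun h => ⟨a - 1, by omega, by omega⟩, by rintro ⟨b, hb, rfl⟩; omega⟩
      rw [hI, Finset.sum_image (by intro a _ b _ h; simpa using h), ← Finset.smul_sum, smul_eq_mul]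
      have : ∑ s ∈ Finset.range t, ℓ (iterate ℓ P η D K (s + 1) v) z
          ≤ ∑ s ∈ Finset.range t, (ℓ (x s) z + (L * c + η * L ^ 2)) := by
        refine Finset.sum_le_sum fun s hs => ?_
        have h1 := loss_le_add hℓ z (iterate ℓ P η D K (s + 1) v) (x (s + 1))
        have h2 := loss_le_add hℓ z (x (s + 1)) (x s)
        have h3 := mul_le_mul_of_nonneg_left (hcons (s + 1) (Finset.mem_range.1 hs) v) hL
        have h4 := mul_le_mul_of_nonneg_left (hstep s) hL
        linarith
      refine (mul_le_mul_of_nonneg_left this (by positivity)).trans (le_of_eq ?_)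
      rw [Finset.sum_add_distrib, mul_add, Finset.sum_const, Finset.card_range, nsmul_eq_mul]
      field_simp
    refine (dataMean_mono fun w i => hz (D w i)).trans (le_of_eq ?_)
    rw [dataMean_add, dataMean_const hn hm,
      dataMean_smul_sum _ _ (fun s w i => ℓ (x s) (D w i))]
    rfl
  -- The tangent of `ℓ(·, D w i)` is taken at the vector of node `w`, where the gradient is computed.
  have hB : ∀ s ∈ Finset.range t, empRisk ℓ D (x s) - empRisk ℓ D y
      ≤ dataMean (fun w (_ : Fin m) => inner ℝ (stochGrad ℓ P η D K s w) (x s - y))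
        - gradNoise ℓ P η D K y s + 2 * L * c := by
    intro s hs
    have hz : ∀ w i, ℓ (x s) (D w i) - ℓ y (D w i)
        ≤ inner ℝ (lossGrad ℓ (iterate ℓ P η D K s w) (D w i)) (x s - y) + 2 * L * c := by
      intro w i
      set X := iterate ℓ P η D K s w
      have hXc : ‖X - x s‖ ≤ c := hcons s (Finset.mem_range.1 hs).le w
      have h1 := loss_le_add hℓ (D w i) (x s) X
      have h2 := add_inner_gradient_le (hℓ.differentiable (D w i)) (hℓ.convex (D w i)) X y
      change ℓ X (D w i) + inner ℝ (lossGrad ℓ X (D w i)) (y - X) ≤ ℓ y (D w i) at h2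
      have h3 : inner ℝ (lossGrad ℓ X (D w i)) (y - X)
          = - inner ℝ (lossGrad ℓ X (D w i)) (x s - y)
            - inner ℝ (lossGrad ℓ X (D w i)) (X - x s) := by
        rw [← inner_neg_right, ← inner_sub_right]; congr 1; abel
      have h4 := (real_inner_le_norm (lossGrad ℓ X (D w i)) (X - x s)).trans
        (mul_le_mul (hℓ.norm_lossGrad_le hL X (D w i)) hXc (norm_nonneg _) hL)
      rw [norm_sub_rev] at h1
      have h5 := mul_le_mul_of_nonneg_left hXc hL
      linarith
    have h := dataMean_mono hz
    rw [dataMean_sub, dataMean_add, dataMean_const hn hm] at h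
    rw [gradNoise, dataMean_sub]
    change empRisk ℓ D (x s) - empRisk ℓ D y ≤ _ at h
    linarith
  have hC := Finset.sum_le_sum hB
  simp only [Finset.sum_sub_distrib, Finset.sum_add_distrib, Finset.sum_const,
    Finset.card_range, nsmul_eq_mul] at hC
  have hreg := sum_inner_stochGrad_le hn hm hP.doublyStochastic hℓ hL hη D K y t
  have hE : 1 / (t : ℝ) * ∑ s ∈ Finset.range t, empRisk ℓ D (x s)
      ≤ empRisk ℓ D y + ‖y‖ ^ 2 / (2 * η * t) + η * L ^ 2 / 2 + 2 * L * c
        - 1 / (t : ℝ) * ∑ s ∈ Finset.range t, gradNoise ℓ P η D K y s := by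
    rw [one_div, inv_mul_le_iff₀ ht0]
    have : (t : ℝ) * (empRisk ℓ D y + ‖y‖ ^ 2 / (2 * η * t) + η * L ^ 2 / 2 + 2 * L * c
        - (t : ℝ)⁻¹ * ∑ s ∈ Finset.range t, gradNoise ℓ P η D K y s)
        = t * empRisk ℓ D y + (‖y‖ ^ 2 / (2 * η) + η * t * L ^ 2 / 2) + t * (2 * L * c)
          - ∑ s ∈ Finset.range t, gradNoise ℓ P η D K y s := by
      field_simp
      ring
    rw [this]
    linarith
  have hc' : L * c = 8 * η * L ^ 2 * (logTerm n t / gap P) := by rw [hc]; ring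
  linarith

/-! ### Stability -/

/-- Replacing one data point changes the iterates, summed over all choices of the data point, by at
most `2 η L` per step: gradient steps with equal data do not expand distances, and a node uses only
one data point at a time. -/
theorem sum_norm_iterate_update_sub_le (hβ : 0 < β) (hηβ : η * β ≤ 2) (hη : 0 ≤ η) (hL : 0 ≤ L)
    (hP : P ∈ doublyStochastic ℝ (Fin n)) (hℓ : IsSmoothLoss μ ℓ L β)
    (e : Fin n × Fin m → 𝒵) (z : 𝒵) (K : ℕ → Fin n → Fin m) (s : ℕ) (v : Fin n) :
    ∑ p, ‖iterate ℓ P η (Function.curry (Function.update e p z)) K s v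
        - iterate ℓ P η (Function.curry e) K s v‖ ≤ 2 * η * L * s := by
  induction s generalizing v with
  | zero => simp [iterate]
  | succ s ih =>
    set X := iterate ℓ P η (Function.curry e) K s with hX
    set Y := fun p => iterate ℓ P η (Function.curry (Function.update e p z)) K s with hY
    have hstep : ∀ p u, ‖(Y p u - η • lossGrad ℓ (Y p u) (Function.update e p z (u, K s u)))
        - (X u - η • lossGrad ℓ (X u) (e (u, K s u)))‖
        ≤ ‖Y p u - X u‖ + if (u, K s u) = p then 2 * η * L else 0 := by
      intro p u
      split_ifs with h
      · have h1 : (Y p u - η • lossGrad ℓ (Y p u) (Function.update e p z (u, K s u)))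
            - (X u - η • lossGrad ℓ (X u) (e (u, K s u)))
            = (Y p u - X u) + η • (lossGrad ℓ (X u) (e (u, K s u))
              - lossGrad ℓ (Y p u) (Function.update e p z (u, K s u))) := by
          rw [smul_sub]; abel
        rw [h1]
        refine (norm_add_le _ _).trans (add_le_add_right ?_ _)
        rw [norm_smul, Real.norm_of_nonneg hη]
        have h2 := (norm_sub_le (lossGrad ℓ (X u) (e (u, K s u)))
          (lossGrad ℓ (Y p u) (Function.update e p z (u, K s u)))).trans
          (add_le_add (hℓ.norm_lossGrad_le hL _ _) (hℓ.norm_lossGrad_le hL _ _))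
        have h3 := mul_le_mul_of_nonneg_left h2 hη
        linarith
      · rw [Function.update_of_ne h, add_zero]
        exact norm_gradient_step_sub_le hβ hη hηβ (hℓ.differentiable _) (hℓ.convex _)
          (hℓ.smooth _) _ _
    have hp : ∀ p, ‖iterate ℓ P η (Function.curry (Function.update e p z)) K (s + 1) v
        - iterate ℓ P η (Function.curry e) K (s + 1) v‖
        ≤ ∑ u, P v u * (‖Y p u - X u‖ + if (u, K s u) = p then 2 * η * L else 0) := by
      intro p
      simp only [iterate]
      rw [← Finset.sum_sub_distrib]
      refine norm_sum_le_of_le _ fun u _ => ?_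
      rw [← smul_sub, norm_smul, Real.norm_of_nonneg (nonneg_of_mem_doublyStochastic hP)]
      exact mul_le_mul_of_nonneg_left (hstep p u) (nonneg_of_mem_doublyStochastic hP)
    refine (Finset.sum_le_sum fun p _ => hp p).trans ?_
    rw [Finset.sum_comm]
    calc ∑ u, ∑ p, P v u * (‖Y p u - X u‖ + if (u, K s u) = p then 2 * η * L else 0)
        ≤ ∑ u, P v u * (2 * η * L * s + 2 * η * L) := by
          refine Finset.sum_le_sum fun u _ => ?_
          rw [← Finset.mul_sum, Finset.sum_add_distrib, Finset.sum_ite_eq,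
            if_pos (Finset.mem_univ _)]
          exact mul_le_mul_of_nonneg_left (add_le_add_left (ih u) _)
            (nonneg_of_mem_doublyStochastic hP)
      _ = 2 * η * L * (s + 1 : ℕ) := by
          rw [← Finset.sum_mul, sum_row_of_mem_doublyStochastic hP]; push_cast; ring

theorem sum_norm_average_update_sub_le (hβ : 0 < β) (hηβ : η * β ≤ 2) (hη : 0 ≤ η) (hL : 0 ≤ L)
    (hP : P ∈ doublyStochastic ℝ (Fin n)) (hℓ : IsSmoothLoss μ ℓ L β)
    (e : Fin n × Fin m → 𝒵) (z : 𝒵) (K : ℕ → Fin n → Fin m) {t : ℕ} (ht : 0 < t) (v : Fin n) :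
    ∑ p, ‖average ℓ P η (Function.curry (Function.update e p z)) K t v
        - average ℓ P η (Function.curry e) K t v‖ ≤ 2 * η * L * t := by
  have ht0 : (0 : ℝ) < t := by exact_mod_cast ht
  calc _ ≤ ∑ p, (1 / (t : ℝ)) * ∑ s ∈ Finset.Icc 1 t,
          ‖iterate ℓ P η (Function.curry (Function.update e p z)) K s v
            - iterate ℓ P η (Function.curry e) K s v‖ := by
        refine Finset.sum_le_sum fun p _ => ?_
        rw [average, average, ← smul_sub, ← Finset.sum_sub_distrib, norm_smul,
          Real.norm_of_nonneg (by positivity)]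
        exact mul_le_mul_of_nonneg_left (norm_sum_le _ _) (by positivity)
    _ = (1 / (t : ℝ)) * ∑ s ∈ Finset.Icc 1 t, ∑ p,
          ‖iterate ℓ P η (Function.curry (Function.update e p z)) K s v
            - iterate ℓ P η (Function.curry e) K s v‖ := by
        rw [← Finset.mul_sum, Finset.sum_comm]
    _ ≤ (1 / (t : ℝ)) * ∑ s ∈ Finset.Icc 1 t, 2 * η * L * t := by
        refine mul_le_mul_of_nonneg_left (Finset.sum_le_sum fun s hs => ?_) (by positivity)
        refine (sum_norm_iterate_update_sub_le hβ hηβ hη hL hP hℓ e z K s v).trans ?_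
        have : (s : ℝ) ≤ t := by exact_mod_cast (Finset.mem_Icc.1 hs).2
        gcongr
    _ = 2 * η * L * t := by
        rw [Finset.sum_const, Nat.card_Icc, nsmul_eq_mul]
        simp
        field_simp

end Pathwise

/-! ### Measurability and integrability -/

section Measurability

variable {d n m : ℕ} {𝒵 : Type*} [MeasurableSpace 𝒵] {μ : Measure 𝒵} {ℓ : Param d → 𝒵 → ℝ}
  {L β η : ℝ} {P : Matrix (Fin n) (Fin n) ℝ}

theorem IsSmoothLoss.measurable_uncurry (hℓ : IsSmoothLoss μ ℓ L β) :
    Measurable (Function.uncurry ℓ) :=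
  measurable_uncurry_of_continuous_of_measurable (fun z => (hℓ.differentiable z).continuous)
    hℓ.measurable

/-- The coordinates of the gradient are limits of difference quotients. -/
theorem IsSmoothLoss.measurable_lossGrad (hℓ : IsSmoothLoss μ ℓ L β) (x : Param d) :
    Measurable (lossGrad ℓ x) := by
  have hcoord : ∀ v : Param d, Measurable fun z => inner ℝ (lossGrad ℓ x z) v := by
    intro v
    refine measurable_of_tendsto_metrizable (f := fun (k : ℕ) z =>
      ((k : ℝ) + 1) * (ℓ (x + (1 / ((k : ℝ) + 1)) • v) z - ℓ x z)) (fun k => ?_) ?_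
    · exact ((hℓ.measurable _).sub (hℓ.measurable _)).const_mul _
    · refine tendsto_pi_nhds.2 fun z => ?_
      have h := (hasDerivAt_comp_line (hℓ.differentiable z) x v 0).tendsto_slope
      have h1 : Filter.Tendsto (fun k : ℕ => 1 / ((k : ℝ) + 1)) Filter.atTop
          (nhdsWithin 0 {0}ᶜ) :=
        tendsto_nhdsWithin_iff.2 ⟨tendsto_one_div_add_atTop_nhds_zero_nat,
          Filter.Eventually.of_forall fun k => by
            have : (0 : ℝ) < 1 / ((k : ℝ) + 1) := by positivity
            exact this.ne'⟩
      have h2 := h.comp h1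
      simp only [zero_smul, add_zero] at h2
      refine h2.congr fun k => ?_
      simp [slope]
  have hsum : lossGrad ℓ x = fun z => ∑ i,
      inner ℝ (lossGrad ℓ x z) (EuclideanSpace.basisFun (Fin d) ℝ i) •
        EuclideanSpace.basisFun (Fin d) ℝ i := by
    funext z
    conv_lhs => rw [← (EuclideanSpace.basisFun (Fin d) ℝ).sum_repr' (lossGrad ℓ x z)]
    exact Finset.sum_congr rfl fun i _ => by rw [real_inner_comm]
  rw [hsum]
  exact Finset.measurable_sum _ fun i _ => (hcoord _).smul_const _

theorem IsSmoothLoss.continuous_lossGrad (hℓ : IsSmoothLoss μ ℓ L β) (hβ : 0 ≤ β) (z : 𝒵) :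
    Continuous fun x => lossGrad ℓ x z :=
  (LipschitzWith.of_dist_le_mul (K := ⟨β, hβ⟩) fun x y => by
    rw [dist_eq_norm, dist_eq_norm]; exact hℓ.smooth z x y).continuous

theorem IsSmoothLoss.measurable_uncurry_lossGrad (hℓ : IsSmoothLoss μ ℓ L β) (hβ : 0 ≤ β) :
    Measurable (Function.uncurry (lossGrad ℓ)) :=
  measurable_uncurry_of_continuous_of_measurable (hℓ.continuous_lossGrad hβ)
    hℓ.measurable_lossGrad

theorem measurable_iterate (hℓ : IsSmoothLoss μ ℓ L β) (hβ : 0 ≤ β) (s : ℕ) (v : Fin n) :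
    Measurable fun q : (Fin n × Fin m → 𝒵) × (ℕ → Fin n → Fin m) =>
      iterate ℓ P η (Function.curry q.1) q.2 s v := by
  induction s generalizing v with
  | zero => exact measurable_const
  | succ s ih =>
    simp only [iterate]
    refine Finset.measurable_sum _ fun w _ => ?_
    have hK : Measurable fun q : (Fin n × Fin m → 𝒵) × (ℕ → Fin n → Fin m) => q.2 s w :=
      (measurable_pi_apply w).comp ((measurable_pi_apply s).comp measurable_snd)
    have hdata : Measurable fun r : (Fin n × Fin m → 𝒵) × Fin m => r.1 (w, r.2) :=
      measurable_from_prod_countable_left fun k => measurable_pi_apply (w, k)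
    have hz : Measurable fun q : (Fin n × Fin m → 𝒵) × (ℕ → Fin n → Fin m) =>
        Function.curry q.1 w (q.2 s w) := hdata.comp (measurable_fst.prodMk hK)
    have hg := (hℓ.measurable_uncurry_lossGrad hβ).comp ((ih w).prodMk hz)
    exact ((ih w).sub (hg.const_smul η)).const_smul (P v w)

theorem measurable_average (hℓ : IsSmoothLoss μ ℓ L β) (hβ : 0 ≤ β) (t : ℕ) (v : Fin n) :
    Measurable fun q : (Fin n × Fin m → 𝒵) × (ℕ → Fin n → Fin m) =>
      average ℓ P η (Function.curry q.1) q.2 t v := by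
  unfold average
  exact (Finset.measurable_sum _ fun s _ => measurable_iterate hℓ hβ s v).const_smul
    (1 / (t : ℝ))

theorem measurable_average_index (hℓ : IsSmoothLoss μ ℓ L β) (hβ : 0 ≤ β)
    (e : Fin n × Fin m → 𝒵) (t : ℕ) (v : Fin n) :
    Measurable fun k : ℕ → Fin n → Fin m => average ℓ P η (Function.curry e) k t v := by
  have h := (measurable_average (n := n) (m := m) (P := P) (η := η) hℓ hβ t v).comp
    (measurable_prodMk_left (x := e))
  exact h

theorem abs_loss_le (hℓ : IsSmoothLoss μ ℓ L β) (hL : 0 ≤ L) {x : Param d} {b : ℝ}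
    (hx : ‖x‖ ≤ b) (z : 𝒵) : |ℓ x z| ≤ |ℓ 0 z| + L * b := by
  have h1 := hℓ.lipschitz z x 0
  rw [sub_zero] at h1
  have h2 := abs_sub_abs_le_abs_sub (ℓ x z) (ℓ 0 z)
  have h3 := mul_le_mul_of_nonneg_left hx hL
  linarith

/-- The loss at a bounded random parameter and a data point with law `μ` (possibly dependent on the
parameter) is integrable. -/
theorem integrable_loss_comp {S : Type*} [MeasurableSpace S] {ρ : Measure S} [IsFiniteMeasure ρ]
    (hℓ : IsSmoothLoss μ ℓ L β) (hL : 0 ≤ L) {A : S → Param d} (hA : Measurable A) {b : ℝ}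
    (hb : ∀ s, ‖A s‖ ≤ b) {ζ : S → 𝒵} (hζ : MeasurePreserving ζ ρ μ) :
    Integrable (fun s => ℓ (A s) (ζ s)) ρ := by
  refine Integrable.mono' (((hζ.integrable_comp_of_integrable (hℓ.integrable 0)).abs).add
    (integrable_const (L * b))) ?_ (Filter.Eventually.of_forall fun s => ?_)
  · exact (hℓ.measurable_uncurry.comp (hA.prodMk hζ.measurable)).aestronglyMeasurable
  · exact abs_loss_le hℓ hL (hb s) (ζ s)

theorem abs_testRisk_sub_le [IsProbabilityMeasure μ] (hℓ : IsSmoothLoss μ ℓ L β)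
    (x y : Param d) : |testRisk μ ℓ x - testRisk μ ℓ y| ≤ L * ‖x - y‖ := by
  rw [testRisk, testRisk, ← integral_sub (hℓ.integrable x) (hℓ.integrable y)]
  have h := norm_integral_le_of_norm_le_const (μ := μ) (f := fun z => ℓ x z - ℓ y z)
    (C := L * ‖x - y‖) (Filter.Eventually.of_forall fun z => hℓ.lipschitz z x y)
  simpa using h

theorem continuous_testRisk [IsProbabilityMeasure μ] (hℓ : IsSmoothLoss μ ℓ L β) (hL : 0 ≤ L) :
    Continuous (testRisk μ ℓ) :=
  (LipschitzWith.of_dist_le_mul (K := ⟨L, hL⟩) fun x y => by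
    rw [Real.dist_eq, dist_eq_norm]; exact abs_testRisk_sub_le hℓ x y).continuous

theorem integrable_testRisk_comp {S : Type*} [MeasurableSpace S] {ρ : Measure S}
    [IsFiniteMeasure ρ] [IsProbabilityMeasure μ] (hℓ : IsSmoothLoss μ ℓ L β) (hL : 0 ≤ L)
    {A : S → Param d} (hA : Measurable A) {b : ℝ} (hb : ∀ s, ‖A s‖ ≤ b) :
    Integrable (fun s => testRisk μ ℓ (A s)) ρ := by
  refine Integrable.of_bound
    ((continuous_testRisk hℓ hL).measurable.comp hA).aestronglyMeasurable
    (|testRisk μ ℓ 0| + L * b) (Filter.Eventually.of_forall fun s => ?_)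
  have h1 := abs_testRisk_sub_le hℓ (A s) 0
  rw [sub_zero] at h1
  have h2 := abs_sub_abs_le_abs_sub (testRisk μ ℓ (A s)) (testRisk μ ℓ 0)
  have h3 := mul_le_mul_of_nonneg_left (hb s) hL
  rw [Real.norm_eq_abs]
  linarith

/-- The empirical risk at a bounded random parameter is integrable, if all data points have
law `μ`. -/
theorem integrable_empRisk_comp {S : Type*} [MeasurableSpace S] {ρ : Measure S}
    [IsFiniteMeasure ρ] (hℓ : IsSmoothLoss μ ℓ L β) (hL : 0 ≤ L)
    {A : S → Param d} (hA : Measurable A) {b : ℝ} (hb : ∀ s, ‖A s‖ ≤ b)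
    {ζ : S → Fin n → Fin m → 𝒵} (hζ : ∀ w i, MeasurePreserving (fun s => ζ s w i) ρ μ) :
    Integrable (fun s => empRisk ℓ (ζ s) (A s)) ρ :=
  (integrable_finsetSum _ fun w _ => integrable_finsetSum _ fun i _ =>
    integrable_loss_comp hℓ hL hA hb (hζ w i)).const_mul _

end Measurability

/-! ### Generalisation error -/

section Generalisation

theorem measurePreserving_update {ι 𝒵 : Type*} [Fintype ι] [DecidableEq ι] [MeasurableSpace 𝒵]
    (μ : Measure 𝒵) [IsProbabilityMeasure μ] (i : ι) :
    MeasurePreserving (fun q : (ι → 𝒵) × 𝒵 => Function.update q.1 i q.2)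
      ((Measure.pi fun _ => μ).prod μ) (Measure.pi fun _ => μ) := by
  have hmeas : Measurable fun q : (ι → 𝒵) × 𝒵 => Function.update q.1 i q.2 := by
    refine measurable_pi_lambda _ fun j => ?_
    by_cases h : j = i
    · subst h; simpa using measurable_snd
    · simp only [Function.update_of_ne h]
      exact (measurable_pi_apply j).comp measurable_fst
  refine ⟨hmeas, (Measure.pi_eq fun s hs => ?_).symm⟩
  rw [Measure.map_apply hmeas (MeasurableSet.univ_pi hs)]
  have hpre : (fun q : (ι → 𝒵) × 𝒵 => Function.update q.1 i q.2) ⁻¹' (Set.univ.pi s)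
      = (Set.univ.pi (Function.update s i Set.univ)) ×ˢ (s i) := by
    ext q
    simp only [Set.mem_preimage, Set.mem_pi, Set.mem_univ, true_implies, Set.mem_prod]
    constructor
    · intro h
      refine ⟨fun j => ?_, by simpa using h i⟩
      by_cases hj : j = i
      · subst hj; simp
      · simpa [Function.update_of_ne hj] using h j
    · rintro ⟨h1, h2⟩ j
      by_cases hj : j = i
      · subst hj; simpa using h2
      · simpa [Function.update_of_ne hj] using h1 j
  rw [hpre, Measure.prod_prod, Measure.pi_pi, ← Finset.mul_prod_erase _ _ (Finset.mem_univ i),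
    ← Finset.mul_prod_erase _ _ (Finset.mem_univ i), Function.update_self, measure_univ, one_mul,
    mul_comm]
  congr 1
  refine Finset.prod_congr rfl fun j hj => ?_
  rw [Function.update_of_ne (Finset.ne_of_mem_erase hj)]

variable {d n m : ℕ} {𝒵 : Type*} [MeasurableSpace 𝒵] {μ : Measure 𝒵} {ℓ : Param d → 𝒵 → ℝ}
  {L β η : ℝ} {P : Matrix (Fin n) (Fin n) ℝ}

/-- Stability implies generalisation. The loss at a fresh data point `z` is compared with the loss
at a data point of the sample; resampling the latter as `z` turns the difference of the two
expectations into the effect of replacing one data point. -/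
theorem integral_testRisk_le_of_stable [IsProbabilityMeasure μ] (hn : 0 < n) (hm : 0 < m)
    (hℓ : IsSmoothLoss μ ℓ L β) (hL : 0 ≤ L) {A : (Fin n × Fin m → 𝒵) → Param d}
    (hA : Measurable A) {b : ℝ} (hb : ∀ e, ‖A e‖ ≤ b) {S : ℝ}
    (hS : ∀ e z, ∑ p, ‖A (Function.update e p z) - A e‖ ≤ S) :
    ∫ e, testRisk μ ℓ (A e) ∂(Measure.pi fun _ : Fin n × Fin m => μ)
      ≤ ∫ e, empRisk ℓ (Function.curry e) (A e) ∂(Measure.pi fun _ : Fin n × Fin m => μ)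
        + L * S / ((n : ℝ) * m) := by
  set ν := Measure.pi fun _ : Fin n × Fin m => μ with hν
  have hnm : (0 : ℝ) < (n : ℝ) * m := by positivity
  have hsnd : MeasurePreserving (Prod.snd : (Fin n × Fin m → 𝒵) × 𝒵 → 𝒵) (ν.prod μ) μ :=
    measurePreserving_snd
  have hI0 : Integrable (fun q : (Fin n × Fin m → 𝒵) × 𝒵 => ℓ (A q.1) q.2) (ν.prod μ) :=
    integrable_loss_comp hℓ hL (hA.comp measurable_fst) (fun q => hb q.1) hsnd
  have hIp : ∀ p, Integrable (fun q : (Fin n × Fin m → 𝒵) × 𝒵 =>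
      ℓ (A (Function.update q.1 p q.2)) q.2) (ν.prod μ) := fun p =>
    integrable_loss_comp hℓ hL (hA.comp (measurePreserving_update μ p).measurable)
      (fun q => hb _) hsnd
  have hIe : ∀ p, Integrable (fun e : Fin n × Fin m → 𝒵 => ℓ (A e) (e p)) ν := fun p =>
    integrable_loss_comp hℓ hL hA hb (measurePreserving_eval _ p)
  have htest : ∫ e, testRisk μ ℓ (A e) ∂ν = ∫ q, ℓ (A q.1) q.2 ∂(ν.prod μ) :=
    (integral_prod _ hI0).symm
  have hresample : ∀ p, ∫ e, ℓ (A e) (e p) ∂ν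
      = ∫ q, ℓ (A (Function.update q.1 p q.2)) q.2 ∂(ν.prod μ) := by
    intro p
    have hmp := measurePreserving_update μ p
    have h := integral_map (μ := ν.prod μ) hmp.measurable.aemeasurable
      (f := fun e : Fin n × Fin m → 𝒵 => ℓ (A e) (e p)) (by
        rw [hmp.map_eq]; exact (hIe p).aestronglyMeasurable)
    rw [hmp.map_eq] at h
    simpa using h
  have hemp : ∫ e, empRisk ℓ (Function.curry e) (A e) ∂ν
      = (1 / ((n : ℝ) * m)) * ∑ p, ∫ e, ℓ (A e) (e p) ∂ν := by
    rw [← integral_finsetSum _ fun p _ => hIe p, ← integral_const_mul]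
    congr 1
    funext e
    rw [empRisk, Fintype.sum_prod_type]
    rfl
  have hsum : ∑ p : Fin n × Fin m, (∫ q, ℓ (A q.1) q.2 ∂(ν.prod μ)
      - ∫ q, ℓ (A (Function.update q.1 p q.2)) q.2 ∂(ν.prod μ)) ≤ L * S := by
    have h1 : ∀ p : Fin n × Fin m, (∫ q, ℓ (A q.1) q.2 ∂(ν.prod μ)
        - ∫ q, ℓ (A (Function.update q.1 p q.2)) q.2 ∂(ν.prod μ))
        = ∫ q, (ℓ (A q.1) q.2 - ℓ (A (Function.update q.1 p q.2)) q.2) ∂(ν.prod μ) := fun p =>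
      (integral_sub hI0 (hIp p)).symm
    simp only [h1]
    rw [← integral_finsetSum Finset.univ (f := fun p (q : (Fin n × Fin m → 𝒵) × 𝒵) =>
      ℓ (A q.1) q.2 - ℓ (A (Function.update q.1 p q.2)) q.2) fun p _ => hI0.sub (hIp p)]
    calc _ ≤ ∫ _q, L * S ∂(ν.prod μ) := by
          refine integral_mono (integrable_finsetSum _ fun p _ => hI0.sub (hIp p))
            (integrable_const _) fun q => ?_
          calc _ ≤ ∑ p, L * ‖A (Function.update q.1 p q.2) - A q.1‖ := by
                refine Finset.sum_le_sum fun p _ => ?_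
                have := loss_le_add hℓ q.2 (A q.1) (A (Function.update q.1 p q.2))
                rw [norm_sub_rev] at this
                linarith
            _ ≤ L * S := by
                rw [← Finset.mul_sum]
                exact mul_le_mul_of_nonneg_left (hS q.1 q.2) hL
      _ = L * S := by simp
  rw [htest, hemp]
  simp only [hresample]
  rw [Finset.sum_sub_distrib, Finset.sum_const, Finset.card_univ, Fintype.card_prod,
    Fintype.card_fin, Fintype.card_fin, nsmul_eq_mul] at hsum
  push_cast at hsum
  rw [one_div, ← div_eq_inv_mul, ← add_div, le_div_iff₀ hnm]
  linarith

end Generalisation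

/-! ### Expected optimisation error -/

section Noise

variable {d n m : ℕ} {𝒵 Ω : Type*} [MeasurableSpace Ω] {ℓ : Param d → 𝒵 → ℝ} {η : ℝ}
  {P : Matrix (Fin n) (Fin n) ℝ} {Pr : Measure Ω} {K : ℕ → Ω → Fin n → Fin m}

theorem iterate_congr (D : Fin n → Fin m → 𝒵) {k k' : ℕ → Fin n → Fin m} {s : ℕ}
    (h : ∀ j < s, k j = k' j) : iterate ℓ P η D k s = iterate ℓ P η D k' s := by
  induction s with
  | zero => rfl
  | succ s ih =>
    funext v
    simp only [iterate, ih fun j hj => h j (hj.trans s.lt_succ_self), h s s.lt_succ_self]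

/-- Extends an index sequence known before time `s` by the index `0`. -/
def extendIndex (hm : 0 < m) (s : ℕ) (a : Finset.range s → Fin n → Fin m) :
    ℕ → Fin n → Fin m :=
  fun j => if h : j ∈ Finset.range s then a ⟨j, h⟩ else fun _ => ⟨0, hm⟩

theorem iterate_extendIndex (hm : 0 < m) (D : Fin n → Fin m → 𝒵) (k : ℕ → Fin n → Fin m)
    (s : ℕ) :
    iterate ℓ P η D (extendIndex hm s fun j => k j) s = iterate ℓ P η D k s :=
  iterate_congr D fun j hj => by simp [extendIndex, hj]

/-- The integral of a quantity that depends on the past and on an index which is uniform and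
independent of the past is the mean over the values of the index. -/
theorem integral_past_index [IsProbabilityMeasure Pr] (hK : ∀ s, Measurable (K s))
    (hunif : ∀ s v k, Pr.real {ω | K s ω v = k} = 1 / (m : ℝ)) (hindep : iIndepFun K Pr)
    (s : ℕ) (w : Fin n) (F : (Finset.range s → Fin n → Fin m) → Fin m → ℝ) :
    Integrable (fun ω => F (fun j => K j ω) (K s ω w)) Pr ∧
    ∫ ω, F (fun j => K j ω) (K s ω w) ∂Pr
      = (1 / (m : ℝ)) * ∑ i, ∫ ω, F (fun j => K j ω) i ∂Pr := by
  have hpast : Measurable fun ω (j : Finset.range s) => K j ω :=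
    measurable_pi_lambda _ fun j => hK j
  have hFint : ∀ i, Integrable (fun ω => F (fun j => K j ω) i) Pr := fun i =>
    (Integrable.of_finite (f := fun a => F a i)).comp_measurable hpast
  have hset : ∀ i, MeasurableSet {ω | K s ω w = i} := fun i =>
    (measurable_pi_apply w).comp (hK s) (MeasurableSet.singleton i)
  have hind : ∀ i, Integrable (fun ω =>
      F (fun j => K j ω) i * Set.indicator {ω | K s ω w = i} 1 ω) Pr := by
    intro i
    refine ((hFint i).indicator (hset i)).congr (Filter.Eventually.of_forall fun ω => ?_)
    by_cases h : ω ∈ {ω | K s ω w = i} <;> simp [Set.indicator, h]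
  have hsplit : (fun ω => F (fun j => K j ω) (K s ω w)) = fun ω => ∑ i,
      F (fun j => K j ω) i * Set.indicator {ω | K s ω w = i} 1 ω := by
    funext ω
    simp [Set.indicator]
  have hval : ∀ i, ∫ ω, F (fun j => K j ω) i * Set.indicator {ω | K s ω w = i} 1 ω ∂Pr
      = (1 / (m : ℝ)) * ∫ ω, F (fun j => K j ω) i ∂Pr := by
    intro i
    have h1 := hindep.indepFun_finset (Finset.range s) {s} (by simp) hK
    have h2 := h1.comp (φ := fun a => F a i)
      (ψ := fun b : ({s} : Finset ℕ) → Fin n → Fin m =>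
        Set.indicator {b | b ⟨s, Finset.mem_singleton_self s⟩ w = i}
          (1 : (({s} : Finset ℕ) → Fin n → Fin m) → ℝ) b)
      (measurable_of_finite _) (measurable_of_finite _)
    have h3 := h2.integral_fun_mul_eq_mul_integral (hFint i).aestronglyMeasurable (by
      exact ((measurable_one.indicator (hset i)) :
        Measurable (Set.indicator {ω | K s ω w = i} (1 : Ω → ℝ))).aestronglyMeasurable)
    have h4 : ∫ ω, Set.indicator {ω | K s ω w = i} (1 : Ω → ℝ) ω ∂Pr = 1 / (m : ℝ) := by
      rw [integral_indicator_one (hset i), hunif]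
    rw [← h4, mul_comm]
    exact h3
  rw [hsplit]
  refine ⟨integrable_finsetSum _ fun i _ => hind i, ?_⟩
  rw [integral_finsetSum _ fun i _ => hind i, Finset.mul_sum]
  exact Finset.sum_congr rfl fun i _ => hval i

/-- The stochastic gradient is unbiased given the past, so the noise term has mean zero. -/
theorem integral_gradNoise [IsProbabilityMeasure Pr] (hm : 0 < m) (hK : ∀ s, Measurable (K s))
    (hunif : ∀ s v k, Pr.real {ω | K s ω v = k} = 1 / (m : ℝ)) (hindep : iIndepFun K Pr)
    (D : Fin n → Fin m → 𝒵) (y : Param d) (s : ℕ) :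
    Integrable (fun ω => gradNoise ℓ P η D (fun s => K s ω) y s) Pr ∧
    ∫ ω, gradNoise ℓ P η D (fun s => K s ω) y s ∂Pr = 0 := by
  have hm0 : (m : ℝ) ≠ 0 := by positivity
  set F : Fin n → (Finset.range s → Fin n → Fin m) → Fin m → ℝ := fun w a i =>
    inner ℝ (lossGrad ℓ (iterate ℓ P η D (extendIndex hm s a) s w) (D w i))
      (netAverage ℓ P η D (extendIndex hm s a) s - y) with hF
  have hpast : Measurable fun ω (j : Finset.range s) => K j ω :=
    measurable_pi_lambda _ fun j => hK j
  have hnoise : (fun ω => gradNoise ℓ P η D (fun s => K s ω) y s) = fun ω =>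
      (1 / ((n : ℝ) * m)) * ∑ w, ∑ i,
        (F w (fun j => K j ω) (K s ω w) - F w (fun j => K j ω) i) := by
    funext ω
    have h1 := iterate_extendIndex (ℓ := ℓ) (P := P) (η := η) hm D (fun s => K s ω) s
    have h2 : netAverage ℓ P η D (extendIndex hm s fun j => K j ω) s
        = netAverage ℓ P η D (fun s => K s ω) s := by
      rw [netAverage, netAverage, h1]
    simp only [gradNoise, dataMean, hF, stochGrad, h1, h2]
  have hFint : ∀ w i, Integrable (fun ω => F w (fun j => K j ω) i) Pr := fun w i =>
    (Integrable.of_finite (f := fun a => F w a i)).comp_measurable hpast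
  have hF1 := fun w => integral_past_index hK hunif hindep s w (F w)
  have hint : ∀ w i, Integrable (fun ω =>
      F w (fun j => K j ω) (K s ω w) - F w (fun j => K j ω) i) Pr := fun w i =>
    (hF1 w).1.sub (hFint w i)
  rw [hnoise]
  refine ⟨(integrable_finsetSum _ fun w _ => integrable_finsetSum _ fun i _ =>
    hint w i).const_mul _, ?_⟩
  rw [integral_const_mul, integral_finsetSum _ fun w _ => integrable_finsetSum _ fun i _ =>
    hint w i]
  refine mul_eq_zero_of_right _ (Finset.sum_eq_zero fun w _ => ?_)
  rw [integral_finsetSum _ fun i _ => hint w i]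
  have h3 : ∀ i, ∫ ω, (F w (fun j => K j ω) (K s ω w) - F w (fun j => K j ω) i) ∂Pr
      = (1 / (m : ℝ)) * ∑ i, ∫ ω, F w (fun j => K j ω) i ∂Pr
        - ∫ ω, F w (fun j => K j ω) i ∂Pr := fun i => by
    rw [integral_sub (hF1 w).1 (hFint w i), (hF1 w).2]
  simp only [h3]
  rw [Finset.sum_sub_distrib, Finset.sum_const, Finset.card_univ, Fintype.card_fin, nsmul_eq_mul]
  field_simp
  ring

end Noise

/-! ### Test error -/

section TestError

variable {d n m : ℕ} {𝒵 Ω : Type*} [MeasurableSpace 𝒵] [MeasurableSpace Ω] {μ : Measure 𝒵}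
  {Pr : Measure Ω} {ℓ : Param d → 𝒵 → ℝ} {L β η : ℝ} {P : Matrix (Fin n) (Fin n) ℝ}
  {Z : Fin n → Fin m → Ω → 𝒵} {K : ℕ → Ω → Fin n → Fin m}

/-- The expected optimisation error for a fixed dataset, compared with any point of norm at most
`G`. -/
theorem integral_empRisk_average_le [IsProbabilityMeasure Pr] (hn : 0 < n)
    (hm : 0 < m) {graph : SimpleGraph (Fin n)} (hP : IsCommMatrix graph P)
    (hℓ : IsSmoothLoss μ ℓ L β) (hL : 0 ≤ L) (hβ : 0 ≤ β) (hη : 0 < η)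
    (hK : ∀ s, Measurable (K s))
    (hunif : ∀ s v k, Pr.real {ω | K s ω v = k} = 1 / (m : ℝ)) (hindep : iIndepFun K Pr)
    (e : Fin n × Fin m → 𝒵) {t : ℕ} (ht : 0 < t) (v : Fin n) {G : ℝ} {y : Param d}
    (hy : ‖y‖ ≤ G) :
    ∫ ω, empRisk ℓ (Function.curry e)
        (average ℓ P η (Function.curry e) (fun s => K s ω) t v) ∂Pr
      ≤ empRisk ℓ (Function.curry e) y + (G ^ 2 / (2 * η * t) + 3 / 2 * η * L ^ 2
        + 24 * η * L ^ 2 * (logTerm n t / gap P)) := by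
  set D := Function.curry e with hD
  set B := G ^ 2 / (2 * η * t) + 3 / 2 * η * L ^ 2 + 24 * η * L ^ 2 * (logTerm n t / gap P)
  have hKm : Measurable fun ω s => K s ω := measurable_pi_lambda _ hK
  have hA : Measurable fun ω => average ℓ P η D (fun s => K s ω) t v :=
    (measurable_average_index hℓ hβ e t v).comp hKm
  have hb : ∀ ω, ‖average ℓ P η D (fun s => K s ω) t v‖ ≤ η * L * t := fun ω =>
    norm_average_le hℓ hL hη.le hP.doublyStochastic D _ ht v
  have hloss : ∀ w i, Integrable
      (fun ω => ℓ (average ℓ P η D (fun s => K s ω) t v) (D w i)) Pr := fun w i =>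
    Integrable.of_bound ((hℓ.measurable_uncurry.comp
      (hA.prodMk measurable_const)).aestronglyMeasurable) (|ℓ 0 (D w i)| + L * (η * L * t))
      (Filter.Eventually.of_forall fun ω => abs_loss_le hℓ hL (hb ω) _)
  have hint : Integrable
      (fun ω => empRisk ℓ D (average ℓ P η D (fun s => K s ω) t v)) Pr :=
    (integrable_finsetSum _ fun w _ => integrable_finsetSum _ fun i _ => hloss w i).const_mul _
  have hN := fun s => integral_gradNoise (ℓ := ℓ) (P := P) (η := η) hm hK hunif hindep D y s
  have hNint : Integrable (fun ω => 1 / (t : ℝ) * ∑ s ∈ Finset.range t,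
      gradNoise ℓ P η D (fun s => K s ω) y s) Pr :=
    (integrable_finsetSum _ fun s _ => (hN s).1).const_mul _
  have hNzero : ∫ ω, 1 / (t : ℝ) * ∑ s ∈ Finset.range t,
      gradNoise ℓ P η D (fun s => K s ω) y s ∂Pr = 0 := by
    rw [integral_const_mul, integral_finsetSum _ fun s _ => (hN s).1]
    simp [(hN _).2]
  calc _ ≤ ∫ ω, (empRisk ℓ D y + B - 1 / (t : ℝ) * ∑ s ∈ Finset.range t,
        gradNoise ℓ P η D (fun s => K s ω) y s) ∂Pr := by
        refine integral_mono hint ((integrable_const _).sub hNint) fun ω => ?_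
        have h1 := empRisk_average_sub_le hn hm hP hℓ hL hη D (fun s => K s ω) ht v y
        have h2 : ‖y‖ ^ 2 / (2 * η * t) ≤ G ^ 2 / (2 * η * t) := by gcongr
        simp only [B]
        linarith
    _ = empRisk ℓ D y + B := by
        rw [integral_sub (integrable_const _) hNint, hNzero]
        simp

/-- Data and indices together have the product law of an i.i.d. dataset and the index sequence. -/
theorem IsSampling.measurePreserving [IsProbabilityMeasure Pr] [IsProbabilityMeasure μ]
    (hS : IsSampling Pr μ Z K) :
    MeasurePreserving (fun ω => ((fun p : Fin n × Fin m => Z p.1 p.2 ω), fun s => K s ω)) Pr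
      ((Measure.pi fun _ => μ).prod (Pr.map fun ω s => K s ω)) := by
  have hZ : Measurable fun ω (p : Fin n × Fin m) => Z p.1 p.2 ω :=
    measurable_pi_lambda _ fun p => hS.measurable_data p.1 p.2
  have hK : Measurable fun ω s => K s ω := measurable_pi_lambda _ hS.measurable_index
  have hlaw : Pr.map (fun ω (p : Fin n × Fin m) => Z p.1 p.2 ω) = Measure.pi fun _ => μ := by
    rw [(iIndepFun_iff_map_fun_eq_pi_map
      (fun p : Fin n × Fin m => (hS.measurable_data p.1 p.2).aemeasurable)).1 hS.indep_data]
    simp only [hS.law_data]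
  have huncurry : Measurable fun (D : Fin n → Fin m → 𝒵) (p : Fin n × Fin m) => D p.1 p.2 :=
    measurable_pi_lambda _ fun p => (measurable_pi_apply p.2).comp (measurable_pi_apply p.1)
  have hind : IndepFun (fun ω (p : Fin n × Fin m) => Z p.1 p.2 ω) (fun ω s => K s ω) Pr :=
    hS.indep_data_index.comp huncurry measurable_id
  refine ⟨hZ.prodMk hK, ?_⟩
  rw [← hlaw]
  exact (indepFun_iff_map_prod_eq_prod_map_map hZ.aemeasurable hK.aemeasurable).1 hind

/-- The test error bound: the regret, consensus and smoothness terms of the optimisation error, and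
the generalisation error from stability. The minimiser of the empirical risk enters only through
`R(X⋆) ≤ R(x⋆)` for each dataset, so that no measurability of `X⋆` is used. -/
theorem testErrorLE_of_stepSize [IsProbabilityMeasure Pr] [IsProbabilityMeasure μ] (hn : 0 < n)
    (hm : 0 < m) {graph : SimpleGraph (Fin n)} (hP : IsCommMatrix graph P)
    (hℓ : IsSmoothLoss μ ℓ L β) (hS : IsSampling Pr μ Z K) (hL : 0 ≤ L) (hβ : 0 < β)
    (hη : 0 < η) (hηβ : η * β ≤ 2) {G : ℝ} {Xstar : Ω → Param d}
    (hX : IsEmpMinimiser Pr ℓ Z G Xstar) (xstar : Param d) {t : ℕ} (ht : 0 < t) (v : Fin n) :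
    TestErrorLE Pr μ ℓ P Z K xstar η t v
      (G ^ 2 / (2 * η * t) + 3 / 2 * η * L ^ 2 + 24 * η * L ^ 2 * (logTerm n t / gap P)
        + 2 * η * L ^ 2 * t / ((n : ℝ) * m)) := by
  set B := G ^ 2 / (2 * η * t) + 3 / 2 * η * L ^ 2 + 24 * η * L ^ 2 * (logTerm n t / gap P)
    with hB
  set ν := Measure.pi fun _ : Fin n × Fin m => μ with hν
  set ξ := Pr.map fun ω s => K s ω with hξ
  have hKm : Measurable fun ω s => K s ω := measurable_pi_lambda _ hS.measurable_index
  have : IsProbabilityMeasure ξ := Measure.isProbabilityMeasure_map hKm.aemeasurable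
  set A : (Fin n × Fin m → 𝒵) × (ℕ → Fin n → Fin m) → Param d :=
    fun q => average ℓ P η (Function.curry q.1) q.2 t v with hAdef
  have hA : Measurable A := measurable_average hℓ hβ.le t v
  have hb : ∀ q, ‖A q‖ ≤ η * L * t := fun q =>
    norm_average_le hℓ hL hη.le hP.doublyStochastic _ _ ht v
  have hmp := hS.measurePreserving
  have hr : Integrable (fun q => testRisk μ ℓ (A q)) (ν.prod ξ) :=
    integrable_testRisk_comp hℓ hL hA hb
  have hR : Integrable (fun q => empRisk ℓ (Function.curry q.1) (A q)) (ν.prod ξ) :=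
    integrable_empRisk_comp hℓ hL hA hb fun w i =>
      (measurePreserving_eval (fun _ : Fin n × Fin m => μ) (w, i)).comp measurePreserving_fst
  refine ⟨hmp.integrable_comp_of_integrable hr, ?_⟩
  have h1 : ∫ ω, testRisk μ ℓ
      (average ℓ P η (fun v i => Z v i ω) (fun s => K s ω) t v) ∂Pr
      = ∫ q, testRisk μ ℓ (A q) ∂(ν.prod ξ) := by
    have h := integral_map (μ := Pr) hmp.measurable.aemeasurable
      (f := fun q => testRisk μ ℓ (A q)) (by rw [hmp.map_eq]; exact hr.aestronglyMeasurable)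
    rw [hmp.map_eq] at h
    exact h.symm
  -- For a fixed index sequence, stability in the data.
  have h2 : ∫ q, testRisk μ ℓ (A q) ∂(ν.prod ξ)
      ≤ ∫ q, empRisk ℓ (Function.curry q.1) (A q) ∂(ν.prod ξ)
        + L * (2 * η * L * t) / ((n : ℝ) * m) := by
    rw [integral_prod_symm _ hr, integral_prod_symm _ hR]
    have hgen : ∀ k : ℕ → Fin n → Fin m, ∫ e, testRisk μ ℓ (A (e, k)) ∂ν
        ≤ ∫ e, empRisk ℓ (Function.curry e) (A (e, k)) ∂ν
          + L * (2 * η * L * t) / ((n : ℝ) * m) := fun k =>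
      integral_testRisk_le_of_stable hn hm hℓ hL
        (hA.comp (measurable_id.prodMk measurable_const)) (fun e => hb _)
        (fun e z => sum_norm_average_update_sub_le hβ hηβ hη.le hL hP.doublyStochastic hℓ e z k
          ht v)
    refine (integral_mono hr.integral_prod_right
      (hR.integral_prod_right.add (integrable_const _)) hgen).trans (le_of_eq ?_)
    simp only [Pi.add_apply]
    rw [integral_add hR.integral_prod_right (integrable_const _)]
    simp
  -- For a fixed dataset, the optimisation error over the index sequence.
  have h3 : ∫ q, empRisk ℓ (Function.curry q.1) (A q) ∂(ν.prod ξ)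
      ≤ testRisk μ ℓ xstar + B := by
    have hZ : MeasurePreserving (fun ω (p : Fin n × Fin m) => Z p.1 p.2 ω) Pr ν :=
      measurePreserving_fst.comp hmp
    have hint := hR.integral_prod_left
    rw [integral_prod _ hR]
    have h4 := integral_map (μ := Pr) hZ.measurable.aemeasurable
      (f := fun e => ∫ k, empRisk ℓ (Function.curry e) (A (e, k)) ∂ξ)
      (by rw [hZ.map_eq]; exact hint.aestronglyMeasurable)
    rw [hZ.map_eq] at h4
    rw [h4]
    have hdata : ∀ w i, MeasurePreserving (fun ω => Z w i ω) Pr μ := fun w i =>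
      ⟨hS.measurable_data w i, hS.law_data w i⟩
    have hRx : Integrable (fun ω => empRisk ℓ (fun v i => Z v i ω) xstar) Pr :=
      integrable_empRisk_comp hℓ hL measurable_const (fun _ => le_rfl) hdata
    have hRxval : ∫ ω, empRisk ℓ (fun v i => Z v i ω) xstar ∂Pr = testRisk μ ℓ xstar := by
      have hl : ∀ w i, Integrable (fun ω => ℓ xstar (Z w i ω)) Pr := fun w i =>
        (hdata w i).integrable_comp_of_integrable (hℓ.integrable xstar)
      have hv : ∀ w i, ∫ ω, ℓ xstar (Z w i ω) ∂Pr = testRisk μ ℓ xstar := by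
        intro w i
        rw [testRisk, ← hS.law_data w i]
        exact (integral_map (hS.measurable_data w i).aemeasurable
          (hℓ.measurable xstar).aestronglyMeasurable).symm
      simp only [empRisk]
      rw [integral_const_mul, integral_finsetSum _ fun w _ => integrable_finsetSum _ fun i _ =>
        hl w i]
      simp only [integral_finsetSum _ fun i _ => hl _ i, hv]
      exact dataMean_const hn hm _
    calc _ ≤ ∫ ω, (empRisk ℓ (fun v i => Z v i ω) xstar + B) ∂Pr := by
          refine integral_mono_ae (hZ.integrable_comp_of_integrable hint)
            (hRx.add (integrable_const _)) ?_
          filter_upwards [hX] with ω hω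
          have h5 := integral_map (μ := Pr) hKm.aemeasurable
            (f := fun k => empRisk ℓ (fun v i => Z v i ω)
              (A ((fun p : Fin n × Fin m => Z p.1 p.2 ω), k))) (by
              have hm' : Measurable fun k : ℕ → Fin n → Fin m =>
                  A ((fun p : Fin n × Fin m => Z p.1 p.2 ω), k) :=
                hA.comp (measurable_const.prodMk measurable_id)
              exact ((Finset.measurable_sum _ fun w _ => Finset.measurable_sum _ fun i _ =>
                hℓ.measurable_uncurry.comp (hm'.prodMk measurable_const)).const_mul
                  _).aestronglyMeasurable)
          have h6 := integral_empRisk_average_le (Pr := Pr) (K := K) hn hm hP hℓ hL hβ.le hη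
            hS.measurable_index hS.uniform_index hS.indep_index
            (fun p : Fin n × Fin m => Z p.1 p.2 ω) ht v hω.2
          have h7 : empRisk ℓ (fun v i => Z v i ω) (Xstar ω)
              ≤ empRisk ℓ (fun v i => Z v i ω) xstar := hω.1 (Set.mem_univ xstar)
          refine (le_of_eq h5).trans (h6.trans ?_)
          exact add_le_add_left h7 B
      _ = testRisk μ ℓ xstar + B := by
          rw [integral_add hRx (integrable_const _), hRxval]
          simp
  rw [h1]
  have h8 : L * (2 * η * L * t) / ((n : ℝ) * m) = 2 * η * L ^ 2 * t / ((n : ℝ) * m) := by ring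
  linarith

end TestError

/-! ### Unique minimisers -/

section Minimisers

theorem div_add_mul_lt {p q x x₀ : ℝ} (hq : 0 < q) (hx : 0 < x)
    (hp : p = q * x₀ ^ 2) (hne : x ≠ x₀) : p / x₀ + q * x₀ < p / x + q * x := by
  have h : p / x + q * x - (p / x₀ + q * x₀) = q * (x - x₀) ^ 2 / x := by
    rw [hp]; field_simp; ring
  have : 0 < q * (x - x₀) ^ 2 / x :=
    div_pos (mul_pos hq (sq_pos_of_ne_zero (sub_ne_zero.2 hne))) hx
  linarith

theorem isUniquePosMin_of_lt {f : ℝ → ℝ} {a : ℝ} (ha : 0 < a)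
    (h : ∀ x, 0 < x → x ≠ a → f a < f x) : IsUniquePosMin f a := by
  refine ⟨ha, fun x hx => ⟨fun hmin => ?_, ?_⟩⟩
  · by_contra hne
    exact absurd (hmin (Set.mem_Ioi.2 ha)) (not_le.2 (h x hx hne))
  · rintro rfl y hy
    by_cases hne : y = x
    · subst hne; exact le_refl (f y)
    · exact (h y hy hne).le

theorem isUniquePosMin_div_sqrt {f : ℝ → ℝ} {G t Q : ℝ} (hG : 0 < G) (ht : 0 < t) (hQ : 0 < Q)
    (hf : ∀ ρ, 0 < ρ → f ρ = G ^ 2 / (2 * t) / ρ + Q / 2 * ρ) :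
    IsUniquePosMin f (G / √t * (1 / √Q)) := by
  have hpos : 0 < G / √t * (1 / √Q) := by positivity
  refine isUniquePosMin_of_lt hpos fun x hx hne => ?_
  rw [hf x hx, hf _ hpos]
  refine div_add_mul_lt (by positivity) hx ?_ hne
  rw [mul_pow, div_pow, div_pow, Real.sq_sqrt ht.le, Real.sq_sqrt hQ.le]
  field_simp

theorem isUniquePosMin_centralTimeObjective {L κ γ : ℝ} {n m : ℕ} (hL : 0 < L) (hκ : 0 < κ)
    (hγ : 0 < γ) (hn : 0 < n) (hm : 0 < m) :
    IsUniquePosMin (centralTimeObjective L κ γ n m) (3 * κ / (2 * L) * timeScale γ n m) := by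
  have hn' : (0 : ℝ) < n := by exact_mod_cast hn
  have hm' : (0 : ℝ) < m := by exact_mod_cast hm
  have hpos : 0 < 3 * κ / (2 * L) * timeScale γ n m := by unfold timeScale; positivity
  refine isUniquePosMin_of_lt hpos fun x hx hne => ?_
  have hf : ∀ τ, centralTimeObjective L κ γ n m τ
      = 3 * κ / γ / √τ + 2 * L / ((n : ℝ) * m) * √τ := fun τ => by
    rw [centralTimeObjective, div_div]
  rw [hf, hf]
  refine div_add_mul_lt (by positivity) (Real.sqrt_pos.2 hx) ?_
    fun h => hne ((Real.sqrt_inj hx.le hpos.le).1 h)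
  rw [Real.sq_sqrt hpos.le, timeScale]
  field_simp

theorem isUniquePosMin_optTimeObjective {L κ γ : ℝ} {n m : ℕ} (hL : 0 < L) (hκ : 0 < κ)
    (hγ : 0 < γ) (hn : 0 < n) (hm : 0 < m) :
    IsUniquePosMin (optTimeObjective L κ γ n m) (3 * κ / L * timeScale γ n m) := by
  have hn' : (0 : ℝ) < n := by exact_mod_cast hn
  have hm' : (0 : ℝ) < m := by exact_mod_cast hm
  have hpos : 0 < 3 * κ / L * timeScale γ n m := by unfold timeScale; positivity
  have hq : ∀ τ, 0 < τ → 0 < τ * γ / (6 * L * κ) := fun τ hτ => by positivity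
  refine isUniquePosMin_of_lt hpos fun x hx hne => ?_
  have hf : ∀ τ, optTimeObjective L κ γ n m τ
      = 1 / √(τ * γ / (6 * L * κ)) + 2 * L ^ 2 / ((n : ℝ) * m) * √(τ * γ / (6 * L * κ)) := by
    intro τ
    rw [optTimeObjective, ← inv_div (τ * γ), Real.sqrt_inv, one_div]
  rw [hf, hf]
  refine div_add_mul_lt (by positivity) (Real.sqrt_pos.2 (hq x hx)) ?_ fun h => hne ?_
  · rw [Real.sq_sqrt (hq _ hpos).le, timeScale]
    field_simp
    norm_num
  · have h1 := (Real.sqrt_inj (hq x hx).le (hq _ hpos).le).1 h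
    rw [div_left_inj' (by positivity)] at h1
    exact mul_right_cancel₀ hγ.ne' h1

end Minimisers

/-! ### Sizes of the step size parameters and of the error terms -/

section Rates

/-- The radicand in `ρ⋆_Opt`. -/
noncomputable def optRadicand (L σ κ γ Λ : ℝ) : ℝ := 6 * L * κ * (Λ / γ) + σ ^ 2

/-- The constant in front of the error terms `1 / t`, `1 / (ρ t)`, `ρ Λ / γ` and `ρ t / (n m)`. -/
noncomputable def errorConst (L β G : ℝ) : ℝ := G ^ 2 * (β + 1) + 27 * L ^ 2

/-- A common bound for the constants that arise from inserting `ρ⋆`, `ρ⋆_Opt` and `ρ⋆_Test` into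
the error terms. -/
noncomputable def rateConst (L G σ κ c : ℝ) : ℝ :=
  1 + L * c / G + G / (L * c) + √(6 * L * κ + σ ^ 2) / G + G / √(3 * L * κ) + 2 * L / G + G / L
    + G / √(min (L * κ / 3) (L ^ 2))

variable {L β G σ κ c γ Λ t N ρ : ℝ}

theorem stepSize_pos (hβ : 0 < β) (hρ : 0 < ρ) : 0 < stepSize β ρ := by
  unfold stepSize; positivity

theorem stepSize_le (hβ : 0 < β) (hρ : 0 < ρ) : stepSize β ρ ≤ ρ := by
  unfold stepSize
  rw [div_le_iff₀ (by positivity), mul_add, mul_one_div_cancel hρ.ne']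
  nlinarith

theorem stepSize_mul_le (hβ : 0 < β) (hρ : 0 < ρ) : stepSize β ρ * β ≤ 2 := by
  have : 0 < 1 / ρ := by positivity
  unfold stepSize
  rw [one_div_mul_eq_div, div_le_iff₀ (by positivity)]
  linarith

/-- The bound of `testErrorLE_of_stepSize` in terms of `ρ`: here `η ≤ ρ` and `1 / η = β + 1 / ρ`,
and the term `η L²` is dominated by the consensus term, since `Λ / γ ≥ 1 / 2`. -/
theorem error_terms_le (hβ : 0 < β) (hρ : 0 < ρ) (hγ : 0 < γ) (hγ1 : γ ≤ 1)
    (hΛ : 1 / 2 ≤ Λ) (ht : 0 < t) (hN : 0 < N) :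
    G ^ 2 / (2 * stepSize β ρ * t) + 3 / 2 * stepSize β ρ * L ^ 2
        + 24 * stepSize β ρ * L ^ 2 * (Λ / γ) + 2 * stepSize β ρ * L ^ 2 * t / N
      ≤ errorConst L β G * (1 / t + 1 / (ρ * t) + ρ * (Λ / γ) + ρ * t / N) := by
  have hη := stepSize_pos hβ hρ
  have hηρ := stepSize_le hβ hρ
  have h1 : G ^ 2 / (2 * stepSize β ρ * t) = G ^ 2 * β / 2 * (1 / t) + G ^ 2 / 2 * (1 / (ρ * t)) := by
    unfold stepSize; field_simp
  have hT : 1 / 2 ≤ Λ / γ := by rw [le_div_iff₀ hγ]; linarith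
  have hT0 : 0 ≤ Λ / γ := by linarith
  have h2 : stepSize β ρ * L ^ 2 * (Λ / γ) ≤ L ^ 2 * (ρ * (Λ / γ)) := by
    have := mul_le_mul_of_nonneg_right hηρ (mul_nonneg (sq_nonneg L) hT0)
    linarith
  have h3 : stepSize β ρ * L ^ 2 * (1 / 2) ≤ L ^ 2 * (ρ * (Λ / γ)) :=
    (mul_le_mul_of_nonneg_left hT (by positivity)).trans h2
  have h4 : stepSize β ρ * L ^ 2 * t / N ≤ L ^ 2 * (ρ * t / N) := by
    have := mul_le_mul_of_nonneg_right hηρ (by positivity : 0 ≤ L ^ 2 * t / N)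
    calc _ = stepSize β ρ * (L ^ 2 * t / N) := by ring
      _ ≤ ρ * (L ^ 2 * t / N) := this
      _ = _ := by ring
  have h5 : G ^ 2 * β / 2 * (1 / t) ≤ errorConst L β G * (1 / t) := by
    refine mul_le_mul_of_nonneg_right ?_ (by positivity)
    unfold errorConst
    nlinarith [sq_nonneg G, sq_nonneg L, mul_nonneg (sq_nonneg G) hβ.le]
  have h6 : G ^ 2 / 2 * (1 / (ρ * t)) ≤ errorConst L β G * (1 / (ρ * t)) := by
    refine mul_le_mul_of_nonneg_right ?_ (by positivity)
    unfold errorConst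
    nlinarith [sq_nonneg G, sq_nonneg L, mul_nonneg (sq_nonneg G) hβ.le]
  have h7 : 27 * L ^ 2 ≤ errorConst L β G := by
    unfold errorConst
    have : 0 ≤ G ^ 2 * (β + 1) := by positivity
    linarith
  have h8 := mul_le_mul_of_nonneg_right h7 (by positivity : 0 ≤ ρ * (Λ / γ))
  have h9 := mul_le_mul_of_nonneg_right h7 (by positivity : 0 ≤ ρ * t / N)
  have h10 : 0 ≤ L ^ 2 * (ρ * t / N) := by positivity
  have e1 : 3 / 2 * stepSize β ρ * L ^ 2 = 3 * (stepSize β ρ * L ^ 2 * (1 / 2)) := by ring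
  have e2 : 2 * stepSize β ρ * L ^ 2 * t / N = 2 * (stepSize β ρ * L ^ 2 * t / N) := by ring
  rw [h1, e1, e2]
  linarith

theorem rateConst_ge (hL : 0 < L) (hG : 0 < G) (hκ : 0 < κ) (hc : 0 < c) :
    1 + L * c / G + G / (L * c) ≤ rateConst L G σ κ c ∧
    1 + √(6 * L * κ + σ ^ 2) / G + G / √(3 * L * κ) + 2 * L / G + G / L ≤ rateConst L G σ κ c ∧
    G / √(min (L * κ / 3) (L ^ 2)) ≤ rateConst L G σ κ c := by
  have h1 : 0 < L * c / G := by positivity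
  have h2 : 0 < G / (L * c) := by positivity
  have h3 : 0 ≤ √(6 * L * κ + σ ^ 2) / G := by positivity
  have h4 : 0 ≤ G / √(3 * L * κ) := by positivity
  have h5 : 0 < 2 * L / G := by positivity
  have h6 : 0 < G / L := by positivity
  have h7 : 0 ≤ G / √(min (L * κ / 3) (L ^ 2)) := by positivity
  unfold rateConst
  refine ⟨?_, ?_, ?_⟩ <;> linarith

/-- The error terms for `ρ⋆`. -/
theorem central_terms_le (hL : 0 < L) (hG : 0 < G) (hκ : 0 < κ) (hc : 0 < c) (hγ : 0 < γ)
    (hγ1 : γ ≤ 1) (hΛ : 1 / 2 ≤ Λ) (ht : 1 ≤ t) (hN : 0 < N) (hρ : ρ = G / (L * c * √t)) :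
    1 / t + 1 / (ρ * t) + ρ * (Λ / γ) + ρ * t / N
      ≤ rateConst L G σ κ c * (2 * Λ) * (1 / (γ * √t) + √t / N) := by
  obtain ⟨r, hr, rfl⟩ : ∃ r, 1 ≤ r ∧ t = r ^ 2 :=
    ⟨√t, Real.one_le_sqrt.2 ht, (Real.sq_sqrt (by linarith)).symm⟩
  have hr0 : 0 < r := by linarith
  rw [Real.sqrt_sq hr0.le] at hρ ⊢
  set a := L * c / G with ha
  set b := G / (L * c) with hb
  have ha0 : 0 < a := by positivity
  have hb0 : 0 < b := by positivity
  have hM : 1 + a + b ≤ rateConst L G σ κ c := (rateConst_ge hL hG hκ hc).1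
  have hY : 1 / r ≤ 1 / (γ * r) := one_div_le_one_div_of_le (by positivity) (by nlinarith)
  have h1 : 1 / r ^ 2 ≤ 1 / r := one_div_le_one_div_of_le hr0 (by nlinarith)
  have h2 : 1 / (ρ * r ^ 2) = a * (1 / r) := by rw [hρ, ha]; field_simp
  have h3 : ρ * (Λ / γ) = b * Λ * (1 / (γ * r)) := by rw [hρ, hb]; field_simp
  have h4 : ρ * r ^ 2 / N = b * (r / N) := by rw [hρ, hb]; field_simp
  set Y := 1 / (γ * r)
  set W := r / N
  have hY0 : 0 < Y := by positivity
  have hW0 : 0 < W := by positivity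
  have hu : 1 ≤ 2 * Λ := by linarith
  have e1 : 1 * Y ≤ 2 * Λ * Y := mul_le_mul_of_nonneg_right hu hY0.le
  have e2 : a * Y ≤ 2 * Λ * (a * Y) := le_mul_of_one_le_left (by positivity) hu
  have e3 : b * W ≤ 2 * Λ * (b * W) := le_mul_of_one_le_left (by positivity) hu
  have e4 : a * (1 / r) ≤ a * Y := mul_le_mul_of_nonneg_left hY ha0.le
  have e5 := mul_le_mul_of_nonneg_right hM (by positivity : 0 ≤ 2 * Λ * (Y + W))
  have e6 : 0 ≤ b * Λ * Y := by positivity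
  have e7 : 0 ≤ (1 + a) * (2 * Λ * W) := by positivity
  rw [h2, h3, h4]
  linarith

/-- The radicand of `ρ⋆_Opt` is of the order `1 / γ`, up to a logarithm. -/
theorem optRadicand_bounds (hL : 0 < L) (hκ : 0 < κ) (hγ : 0 < γ) (hγ1 : γ ≤ 1)
    (hΛ : 1 / 2 ≤ Λ) :
    3 * L * κ / γ ≤ optRadicand L σ κ γ Λ ∧
      optRadicand L σ κ γ Λ ≤ (6 * L * κ + σ ^ 2) * (2 * Λ) / γ := by
  have h1 : 1 / γ ≤ 2 * (Λ / γ) := by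
    rw [← mul_div_assoc]; exact div_le_div_of_nonneg_right (by linarith) hγ.le
  have h2 : 1 ≤ 1 / γ := by rw [le_div_iff₀ hγ]; linarith
  have hLκ : 0 < L * κ := mul_pos hL hκ
  constructor
  · have := mul_le_mul_of_nonneg_left h1 hLκ.le
    have e : 3 * L * κ / γ = 3 * (L * κ * (1 / γ)) := by ring
    unfold optRadicand
    rw [e]
    nlinarith [sq_nonneg σ]
  · have e : (6 * L * κ + σ ^ 2) * (2 * Λ) / γ
        = 6 * L * κ * (Λ / γ) + 6 * L * κ * (Λ / γ) + σ ^ 2 * (2 * (Λ / γ)) := by ring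
    have h3 : 0 ≤ 6 * L * κ * (Λ / γ) := by
      have : 0 < Λ := by linarith
      positivity
    have h4 : σ ^ 2 * 1 ≤ σ ^ 2 * (2 * (Λ / γ)) :=
      mul_le_mul_of_nonneg_left (h2.trans h1) (sq_nonneg σ)
    unfold optRadicand
    rw [e]
    linarith

theorem div_mul_one_div_sqrt_le {q Q : ℝ} (hG : 0 < G) (hq : 0 < q) (hqQ : q ≤ Q) :
    G / √t * (1 / √Q) ≤ G / √t * (1 / √q) := by
  refine mul_le_mul_of_nonneg_left ?_ (by positivity)
  exact one_div_le_one_div_of_le (Real.sqrt_pos.2 hq) (Real.sqrt_le_sqrt hqQ)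

theorem rhoOpt_size (hL : 0 < L) (hG : 0 < G) (hκ : 0 < κ) (hγ : 0 < γ) (hγ1 : γ ≤ 1)
    (hΛ : 1 / 2 ≤ Λ) :
    G / √t * (1 / √(optRadicand L σ κ γ Λ)) ≤ G / √(3 * L * κ) * √(γ / t) := by
  refine (div_mul_one_div_sqrt_le hG (by positivity)
    (optRadicand_bounds hL hκ hγ hγ1 hΛ).1).trans (le_of_eq ?_)
  rw [Real.sqrt_div (by positivity), Real.sqrt_div hγ.le]
  field_simp

theorem sqrt_optRadicand_le (hL : 0 < L) (hκ : 0 < κ) (hγ : 0 < γ) (hγ1 : γ ≤ 1)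
    (hΛ : 1 / 2 ≤ Λ) :
    √(optRadicand L σ κ γ Λ) ≤ √(6 * L * κ + σ ^ 2) * (2 * Λ) / √γ := by
  have hu : 1 ≤ 2 * Λ := by linarith
  refine Real.sqrt_le_iff.2 ⟨by positivity, ?_⟩
  rw [div_pow, mul_pow, Real.sq_sqrt (by positivity), Real.sq_sqrt hγ.le]
  refine (optRadicand_bounds hL hκ hγ hγ1 hΛ).2.trans ?_
  gcongr
  nlinarith

/-- For a radicand `Q`, the term `1 / (ρ t)` with `ρ = G / √t * (1 / √Q)`. -/
theorem one_div_rho_mul (hG : 0 < G) (ht : 0 < t) {Q : ℝ} (hQ : 0 < Q) :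
    1 / (G / √t * (1 / √Q) * t) = √Q / (G * √t) := by
  obtain ⟨r, hr, rfl⟩ : ∃ r, 0 < r ∧ t = r ^ 2 :=
    ⟨√t, Real.sqrt_pos.2 ht, (Real.sq_sqrt ht.le).symm⟩
  rw [Real.sqrt_sq hr.le]
  have : 0 < √Q := Real.sqrt_pos.2 hQ
  field_simp

theorem one_div_le_one_div_sqrt_mul (hγ : 0 < γ) (hγ1 : γ ≤ 1) (ht : 1 ≤ t) :
    1 / t ≤ 1 / √(t * γ) := by
  refine one_div_le_one_div_of_le (Real.sqrt_pos.2 (by positivity)) ?_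
  exact Real.sqrt_le_iff.2 ⟨by linarith, by nlinarith⟩

/-- The consensus term for any `ρ` of order at most `√(γ / t)`. -/
theorem mul_div_gap_le {a : ℝ} (hγ : 0 < γ) (ht : 0 < t) (hΛ : 1 / 2 ≤ Λ) (ha : 0 ≤ a)
    (hρ : ρ ≤ a * √(γ / t)) : ρ * (Λ / γ) ≤ a * (2 * Λ) * (1 / √(t * γ)) := by
  have hΛ0 : 0 < Λ := by linarith
  have h1 := mul_le_mul_of_nonneg_right hρ (by positivity : 0 ≤ Λ / γ)
  refine h1.trans ?_
  rw [Real.sqrt_div hγ.le, Real.sqrt_mul ht.le]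
  obtain ⟨b, hb, rfl⟩ : ∃ b, 0 < b ∧ γ = b ^ 2 :=
    ⟨√γ, Real.sqrt_pos.2 hγ, (Real.sq_sqrt hγ.le).symm⟩
  rw [Real.sqrt_sq hb.le]
  have hr : 0 < √t := Real.sqrt_pos.2 ht
  have e : a * (b / √t) * (Λ / b ^ 2) = a * Λ * (1 / (√t * b)) := by field_simp
  rw [e]
  gcongr
  linarith

/-- The error terms for `ρ⋆_Opt`. -/
theorem opt_terms_le (hL : 0 < L) (hG : 0 < G) (hκ : 0 < κ) (hc : 0 < c) (hγ : 0 < γ)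
    (hγ1 : γ ≤ 1) (hΛ : 1 / 2 ≤ Λ) (ht : 1 ≤ t) (hN : 0 < N)
    (hρ : ρ = G / √t * (1 / √(optRadicand L σ κ γ Λ))) :
    1 / t + 1 / (ρ * t) + ρ * (Λ / γ) + ρ * t / N
      ≤ rateConst L G σ κ c * (2 * Λ) * (1 / √(t * γ) + √(t * γ) / N) := by
  have ht0 : 0 < t := by linarith
  have hu : 1 ≤ 2 * Λ := by linarith
  have hQ : 0 < optRadicand L σ κ γ Λ :=
    lt_of_lt_of_le (by positivity) (optRadicand_bounds hL hκ hγ hγ1 hΛ).1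
  have hρ2 : ρ ≤ G / √(3 * L * κ) * √(γ / t) := hρ ▸ rhoOpt_size hL hG hκ hγ hγ1 hΛ
  have h1 := one_div_le_one_div_sqrt_mul hγ hγ1 ht
  have h2 : 1 / (ρ * t) ≤ √(6 * L * κ + σ ^ 2) / G * (2 * Λ) * (1 / √(t * γ)) := by
    rw [hρ, one_div_rho_mul hG ht0 hQ, Real.sqrt_mul ht0.le]
    calc _ ≤ √(6 * L * κ + σ ^ 2) * (2 * Λ) / √γ / (G * √t) := by
          gcongr; exact sqrt_optRadicand_le hL hκ hγ hγ1 hΛ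
      _ = _ := by field_simp
  have h3 := mul_div_gap_le (a := G / √(3 * L * κ)) hγ ht0 hΛ (by positivity) hρ2
  have h4 : ρ * t / N ≤ G / √(3 * L * κ) * (√(t * γ) / N) := by
    rw [← mul_div_assoc]
    refine div_le_div_of_nonneg_right ?_ hN.le
    refine (mul_le_mul_of_nonneg_right hρ2 ht0.le).trans (le_of_eq ?_)
    rw [Real.sqrt_div hγ.le, Real.sqrt_mul ht0.le, mul_assoc, div_mul_eq_mul_div (√γ),
      mul_div_assoc (√γ), Real.div_sqrt, mul_comm √γ]
  have hM := (rateConst_ge (σ := σ) hL hG hκ hc).2.1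
  have hp : 0 ≤ √(6 * L * κ + σ ^ 2) / G := by positivity
  have hq : 0 ≤ G / √(3 * L * κ) := by positivity
  have hr : 0 < 2 * L / G := by positivity
  have hs : 0 < G / L := by positivity
  set p := √(6 * L * κ + σ ^ 2) / G
  set q := G / √(3 * L * κ)
  set Y := 1 / √(t * γ)
  set W := √(t * γ) / N
  have hY0 : 0 ≤ Y := by positivity
  have hW0 : 0 ≤ W := by positivity
  have hM' : 1 + p + q ≤ rateConst L G σ κ c := by linarith
  have e1 : Y ≤ 2 * Λ * Y := le_mul_of_one_le_left hY0 hu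
  have e2 : q * W ≤ 2 * Λ * (q * W) := le_mul_of_one_le_left (by positivity) hu
  have e3 := mul_le_mul_of_nonneg_right hM' (by positivity : 0 ≤ 2 * Λ * (Y + W))
  have e4 : 0 ≤ (1 + p) * (2 * Λ * W) := by positivity
  linarith

theorem rhoTest_le_rhoOpt (hL : 0 < L) (hG : 0 < G) (hκ : 0 < κ) (hγ : 0 < γ) (hγ1 : γ ≤ 1)
    (hΛ : 1 / 2 ≤ Λ) {S : ℝ} (hS : 0 ≤ S) :
    G / √t * (1 / √(optRadicand L σ κ γ Λ + S)) ≤ G / √t * (1 / √(optRadicand L σ κ γ Λ)) :=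
  div_mul_one_div_sqrt_le hG
    (lt_of_lt_of_le (by positivity) (optRadicand_bounds hL hκ hγ hγ1 hΛ).1) (by linarith)

theorem rhoTest_size (hL : 0 < L) (hG : 0 < G) (hκ : 0 < κ) (hγ : 0 < γ) (hγ1 : γ ≤ 1)
    (hΛ : 1 / 2 ≤ Λ) (ht : 0 < t) (hN : 0 < N) :
    G / √t * (1 / √(optRadicand L σ κ γ Λ + 2 * L ^ 2 * (t + 1) / N))
      ≤ G / √(min (L * κ / 3) (L ^ 2)) * (1 / √t * (1 / √(9 / γ + t / N))) := by
  set b := min (L * κ / 3) (L ^ 2) with hb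
  have hb0 : 0 < b := lt_min (by positivity) (by positivity)
  have h1 : b * (9 / γ) ≤ 3 * L * κ / γ := by
    calc b * (9 / γ) ≤ L * κ / 3 * (9 / γ) := by gcongr; exact min_le_left _ _
      _ = _ := by ring
  have h2 : b * (t / N) ≤ 2 * L ^ 2 * (t + 1) / N := by
    rw [← mul_div_assoc]
    refine div_le_div_of_nonneg_right ?_ hN.le
    have : b * t ≤ L ^ 2 * t := mul_le_mul_of_nonneg_right (min_le_right _ _) ht.le
    nlinarith [sq_nonneg L, mul_nonneg (sq_nonneg L) ht.le]
  have h3 := (optRadicand_bounds (σ := σ) hL hκ hγ hγ1 hΛ).1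
  refine (div_mul_one_div_sqrt_le (q := b * (9 / γ + t / N)) hG (by positivity)
    (by linarith)).trans (le_of_eq ?_)
  rw [Real.sqrt_mul hb0.le]
  field_simp

/-- The error terms for `ρ⋆_Test`. Its radicand exceeds that of `ρ⋆_Opt` by a term of order
`t / (n m)`: this bounds the generalisation term by `1 / √(n m)` at all times, and adds a term of the
same size to `1 / (ρ t)`. -/
theorem test_terms_le (hL : 0 < L) (hG : 0 < G) (hκ : 0 < κ) (hc : 0 < c) (hγ : 0 < γ)
    (hγ1 : γ ≤ 1) (hΛ : 1 / 2 ≤ Λ) (ht : 1 ≤ t) (hN : 0 < N)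
    (hρ : ρ = G / √t * (1 / √(optRadicand L σ κ γ Λ + 2 * L ^ 2 * (t + 1) / N))) :
    1 / t + 1 / (ρ * t) + ρ * (Λ / γ) + ρ * t / N
      ≤ rateConst L G σ κ c * (2 * Λ) * (1 / √(t * γ) + 1 / √N) := by
  have ht0 : 0 < t := by linarith
  have hu : 1 ≤ 2 * Λ := by linarith
  have hQ : 0 < optRadicand L σ κ γ Λ :=
    lt_of_lt_of_le (by positivity) (optRadicand_bounds hL hκ hγ hγ1 hΛ).1
  have hS : 0 < 2 * L ^ 2 * (t + 1) / N := by positivity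
  have hρ2 : ρ ≤ G / √(3 * L * κ) * √(γ / t) :=
    hρ ▸ (rhoTest_le_rhoOpt hL hG hκ hγ hγ1 hΛ hS.le).trans (rhoOpt_size hL hG hκ hγ hγ1 hΛ)
  have h1 := one_div_le_one_div_sqrt_mul hγ hγ1 ht
  have hsqrt : √(optRadicand L σ κ γ Λ + 2 * L ^ 2 * (t + 1) / N)
      ≤ √(6 * L * κ + σ ^ 2) * (2 * Λ) / √γ + 2 * L * √t / √N := by
    have h5 : √(2 * L ^ 2 * (t + 1) / N) ≤ 2 * L * √t / √N := by
      refine Real.sqrt_le_iff.2 ⟨by positivity, ?_⟩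
      rw [div_pow, mul_pow, mul_pow, Real.sq_sqrt ht0.le, Real.sq_sqrt hN.le]
      refine div_le_div_of_nonneg_right ?_ hN.le
      nlinarith [sq_nonneg L]
    have h6 : √(optRadicand L σ κ γ Λ + 2 * L ^ 2 * (t + 1) / N)
        ≤ √(optRadicand L σ κ γ Λ) + √(2 * L ^ 2 * (t + 1) / N) := by
      refine Real.sqrt_le_iff.2 ⟨by positivity, ?_⟩
      rw [add_sq, Real.sq_sqrt hQ.le, Real.sq_sqrt hS.le]
      have : 0 ≤ 2 * √(optRadicand L σ κ γ Λ) * √(2 * L ^ 2 * (t + 1) / N) := by positivity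
      linarith
    exact h6.trans (add_le_add (sqrt_optRadicand_le hL hκ hγ hγ1 hΛ) h5)
  have h2 : 1 / (ρ * t) ≤ √(6 * L * κ + σ ^ 2) / G * (2 * Λ) * (1 / √(t * γ))
      + 2 * L / G * (1 / √N) := by
    rw [hρ, one_div_rho_mul hG ht0 (by positivity), Real.sqrt_mul ht0.le]
    calc _ ≤ (√(6 * L * κ + σ ^ 2) * (2 * Λ) / √γ + 2 * L * √t / √N) / (G * √t) := by gcongr
      _ = _ := by field_simp
  have h3 := mul_div_gap_le (a := G / √(3 * L * κ)) hγ ht0 hΛ (by positivity) hρ2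
  have h4 : ρ * t / N ≤ G / L * (1 / √N) := by
    have h5 : L ^ 2 * t / N ≤ optRadicand L σ κ γ Λ + 2 * L ^ 2 * (t + 1) / N := by
      have : L ^ 2 * t / N ≤ 2 * L ^ 2 * (t + 1) / N := by
        refine div_le_div_of_nonneg_right ?_ hN.le
        nlinarith [sq_nonneg L, mul_nonneg (sq_nonneg L) ht0.le]
      linarith
    have h6 := hρ ▸ div_mul_one_div_sqrt_le (t := t) hG (by positivity) h5
    calc ρ * t / N ≤ G / √t * (1 / √(L ^ 2 * t / N)) * t / N := by gcongr
      _ = G / L * (1 / √N) := by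
        rw [Real.sqrt_div (by positivity), Real.sqrt_mul (by positivity), Real.sqrt_sq hL.le]
        obtain ⟨r, hr, hr'⟩ : ∃ r, 0 < r ∧ t = r ^ 2 :=
          ⟨√t, Real.sqrt_pos.2 ht0, (Real.sq_sqrt ht0.le).symm⟩
        obtain ⟨a, ha, ha'⟩ : ∃ a, 0 < a ∧ N = a ^ 2 :=
          ⟨√N, Real.sqrt_pos.2 hN, (Real.sq_sqrt hN.le).symm⟩
        rw [hr', ha', Real.sqrt_sq hr.le, Real.sqrt_sq ha.le]
        field_simp
  have hM := (rateConst_ge (σ := σ) hL hG hκ hc).2.1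
  have hp : 0 ≤ √(6 * L * κ + σ ^ 2) / G := by positivity
  have hq : 0 ≤ G / √(3 * L * κ) := by positivity
  have hr : 0 < 2 * L / G := by positivity
  have hs : 0 < G / L := by positivity
  set p := √(6 * L * κ + σ ^ 2) / G
  set q := G / √(3 * L * κ)
  set a := 2 * L / G
  set b := G / L
  set Y := 1 / √(t * γ)
  set W := 1 / √N
  have hY0 : 0 ≤ Y := by positivity
  have hW0 : 0 ≤ W := by positivity
  have e1 : Y ≤ 2 * Λ * Y := le_mul_of_one_le_left hY0 hu
  have e2 : (a + b) * W ≤ 2 * Λ * ((a + b) * W) := le_mul_of_one_le_left (by positivity) hu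
  have e3 := mul_le_mul_of_nonneg_right hM (by positivity : 0 ≤ 2 * Λ * (Y + W))
  have e4 : 0 ≤ (1 + p + q) * (2 * Λ * W) := by positivity
  have e5 : 0 ≤ (a + b) * (2 * Λ * Y) := by positivity
  linarith

/-! ### Times of the order `n m / γ` -/

/-- The square root of the factor `A Λ ^ j` in the time window is absorbed by
`(1 + A) (2 Λ) ^ j ≥ 1`. -/
theorem sqrt_le_window {A x y u : ℝ} {j : ℕ} (hA : 0 < A) (hΛ : 0 < Λ) (hu : u = 2 * Λ)
    (hu1 : 1 ≤ u) (hx : x ≤ A * Λ ^ j * y) (hy : 0 ≤ y) : √x ≤ (1 + A) * u ^ j * √y := by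
  refine Real.sqrt_le_iff.2 ⟨by positivity, hx.trans ?_⟩
  rw [mul_pow, Real.sq_sqrt hy]
  refine mul_le_mul_of_nonneg_right ?_ hy
  have h1 : Λ ^ j ≤ u ^ j := pow_le_pow_left₀ hΛ.le (by linarith) j
  have h2 : 1 ≤ u ^ j := one_le_pow₀ hu1
  have h3 : A * Λ ^ j ≤ A * u ^ j := mul_le_mul_of_nonneg_left h1 hA.le
  have h4 : A * u ^ j ≤ (1 + A) * u ^ j := by nlinarith
  have h5 : 1 ≤ (1 + A) * u ^ j := by nlinarith
  nlinarith

/-- Error terms decreasing in `t`, at times at least of the order `N / γ`. -/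
theorem terms_le_of_late {w : ℝ} (hγ : 0 < γ) (ht : 0 < t) (hN : 0 < N)
    (h1 : √(N / γ) ≤ w * √t) :
    1 / (γ * √t) ≤ w * (1 / √(N * γ)) ∧ 1 / √(t * γ) ≤ w * (1 / √N) := by
  rw [Real.sqrt_div hN.le] at h1
  rw [Real.sqrt_mul hN.le, Real.sqrt_mul ht.le]
  obtain ⟨r, hr, rfl⟩ : ∃ r, 0 < r ∧ t = r ^ 2 :=
    ⟨√t, Real.sqrt_pos.2 ht, (Real.sq_sqrt ht.le).symm⟩
  obtain ⟨a, ha, rfl⟩ : ∃ a, 0 < a ∧ N = a ^ 2 :=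
    ⟨√N, Real.sqrt_pos.2 hN, (Real.sq_sqrt hN.le).symm⟩
  obtain ⟨b, hb, rfl⟩ : ∃ b, 0 < b ∧ γ = b ^ 2 :=
    ⟨√γ, Real.sqrt_pos.2 hγ, (Real.sq_sqrt hγ.le).symm⟩
  rw [Real.sqrt_sq hr.le, Real.sqrt_sq ha.le, Real.sqrt_sq hb.le] at *
  rw [div_le_iff₀ hb] at h1
  constructor
  · rw [mul_one_div, div_le_div_iff₀ (by positivity) (by positivity)]
    nlinarith
  · rw [mul_one_div, div_le_div_iff₀ (by positivity) (by positivity)]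
    nlinarith

/-- Error terms increasing in `t`, at times at most of the order `N / γ`. -/
theorem terms_le_of_early {w : ℝ} (hγ : 0 < γ) (ht : 0 < t) (hN : 0 < N)
    (h2 : √t ≤ w * √(N / γ)) :
    √t / N ≤ w * (1 / √(N * γ)) ∧ √(t * γ) / N ≤ w * (1 / √N) := by
  rw [Real.sqrt_div hN.le] at h2
  rw [Real.sqrt_mul hN.le, Real.sqrt_mul ht.le]
  obtain ⟨r, hr, rfl⟩ : ∃ r, 0 < r ∧ t = r ^ 2 :=
    ⟨√t, Real.sqrt_pos.2 ht, (Real.sq_sqrt ht.le).symm⟩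
  obtain ⟨a, ha, rfl⟩ : ∃ a, 0 < a ∧ N = a ^ 2 :=
    ⟨√N, Real.sqrt_pos.2 hN, (Real.sq_sqrt hN.le).symm⟩
  obtain ⟨b, hb, rfl⟩ : ∃ b, 0 < b ∧ γ = b ^ 2 :=
    ⟨√γ, Real.sqrt_pos.2 hγ, (Real.sq_sqrt hγ.le).symm⟩
  rw [Real.sqrt_sq hr.le, Real.sqrt_sq ha.le, Real.sqrt_sq hb.le] at *
  rw [mul_div_assoc', le_div_iff₀ hb] at h2
  constructor
  · rw [mul_one_div, div_le_div_iff₀ (by positivity) (by positivity)]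
    nlinarith
  · rw [mul_one_div, div_le_div_iff₀ (by positivity) (by positivity)]
    nlinarith

end Rates

/-! ### A constant for all bounds -/

section Constants

/-- The constant `C` of the theorem. The power of `2` turns powers of `2 Λ ≥ 1` into powers of `Λ`. -/
noncomputable def claimConst (L β G σ κ c A : ℝ) (j : ℕ) : ℝ :=
  2 ^ (j + 1) * (2 * (1 + A) * (1 + errorConst L β G) * rateConst L G σ κ c)

variable {L β G σ κ c A Λ : ℝ} {j : ℕ}

theorem claimConst_mul_pow :
    claimConst L β G σ κ c A j * Λ ^ (j + 1)
      = 2 * (1 + A) * (1 + errorConst L β G) * rateConst L G σ κ c * (2 * Λ) ^ (j + 1) := by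
  rw [claimConst, mul_pow]; ring

theorem errorConst_nonneg (hβ : 0 < β) : 0 ≤ errorConst L β G := by
  unfold errorConst; positivity

theorem one_le_rateConst (hL : 0 < L) (hG : 0 < G) (hκ : 0 < κ) (hc : 0 < c) :
    1 ≤ rateConst L G σ κ c := by
  have h := (rateConst_ge (σ := σ) hL hG hκ hc).1
  have h1 : 0 < L * c / G := by positivity
  have h2 : 0 < G / (L * c) := by positivity
  linarith

theorem claimConst_pos (hL : 0 < L) (hβ : 0 < β) (hG : 0 < G) (hκ : 0 < κ) (hc : 0 < c)
    (hA : 0 < A) : 0 < claimConst L β G σ κ c A j := by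
  have h1 := errorConst_nonneg (L := L) (G := G) hβ
  have h2 := one_le_rateConst (σ := σ) hL hG hκ hc
  unfold claimConst
  have : 0 < rateConst L G σ κ c := by linarith
  positivity

/-- Bounds with the smaller constants imply bounds with `C Λ ^ (j + 1)`. -/
theorem rateConst_le_claimConst (hL : 0 < L) (hβ : 0 < β) (hG : 0 < G) (hκ : 0 < κ) (hc : 0 < c)
    (hA : 0 < A) (hΛ : 1 / 2 ≤ Λ) :
    rateConst L G σ κ c ≤ claimConst L β G σ κ c A j * Λ ^ (j + 1) ∧
    rateConst L G σ κ c ≤ claimConst L β G σ κ c A j ∧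
    errorConst L β G * (rateConst L G σ κ c * (2 * Λ))
      ≤ claimConst L β G σ κ c A j * Λ ^ (j + 1) ∧
    errorConst L β G * (rateConst L G σ κ c * (2 * Λ)) * (2 * ((1 + A) * (2 * Λ) ^ j))
      ≤ claimConst L β G σ κ c A j * Λ ^ (j + 1) := by
  have hE := errorConst_nonneg (L := L) (G := G) hβ
  have hM := one_le_rateConst (σ := σ) hL hG hκ hc
  rw [claimConst_mul_pow, claimConst]
  set E := errorConst L β G
  set M := rateConst L G σ κ c
  have hM0 : 0 < M := by linarith
  have hu : 1 ≤ 2 * Λ := by linarith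
  set u := 2 * Λ
  have huj : 1 ≤ u ^ j := one_le_pow₀ hu
  have huk : 1 ≤ u ^ (j + 1) := one_le_pow₀ hu
  have h2k : (1 : ℝ) ≤ 2 ^ (j + 1) := one_le_pow₀ one_le_two
  have hX : M ≤ 2 * (1 + A) * (1 + E) * M := by
    refine le_mul_of_one_le_left hM0.le ?_
    nlinarith
  have hX0 : 0 ≤ 2 * (1 + A) * (1 + E) * M := by positivity
  refine ⟨hX.trans (le_mul_of_one_le_right hX0 huk), hX.trans (le_mul_of_one_le_left hX0 h2k),
    ?_, ?_⟩
  · have h1 : E * (M * u) ≤ 2 * (1 + A) * (1 + E) * M * u := by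
      have : E * (M * u) ≤ (2 * (1 + A) * (1 + E)) * (M * u) := by
        refine mul_le_mul_of_nonneg_right ?_ (by positivity)
        nlinarith
      linarith
    refine h1.trans ?_
    rw [pow_succ']
    exact mul_le_mul_of_nonneg_left (le_mul_of_one_le_right (by positivity) huj) hX0
  · rw [pow_succ']
    have : 0 ≤ M * u * (2 * ((1 + A) * u ^ j)) := by positivity
    nlinarith

theorem TestErrorLE.mono {d n m : ℕ} {𝒵 Ω : Type*} [MeasurableSpace 𝒵] [MeasurableSpace Ω]
    {Pr : Measure Ω} {μ : Measure 𝒵} {ℓ : Param d → 𝒵 → ℝ} {P : Matrix (Fin n) (Fin n) ℝ}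
    {Z : Fin n → Fin m → Ω → 𝒵} {K : ℕ → Ω → Fin n → Fin m} {xstar : Param d} {η : ℝ} {t : ℕ}
    {v : Fin n} {B B' : ℝ} (h : TestErrorLE Pr μ ℓ P Z K xstar η t v B) (hB : B ≤ B') :
    TestErrorLE Pr μ ℓ P Z K xstar η t v B' :=
  ⟨h.1, h.2.trans hB⟩

end Constants

end DistSGD

/-! ### Rates of the test error -/

theorem mainTheorem3
    -- Lipschitz and smoothness parameters, bound on `X⋆`, gradient bounds, the constant in `ρ⋆`
    (L β G σ κ c : ℝ) (hL : 0 < L) (hβ : 0 < β) (hG : 0 < G) (hσ : 0 < σ) (hκ : 0 < κ) (hc : 0 < c)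
    -- the constant and the power of the logarithm allowed in `t ≃ n m / (1 - σ₂(P))`
    (A : ℝ) (hA : 0 < A) (j : ℕ) :
    ∃ C : ℝ, 0 < C ∧ ∃ k : ℕ,
      ∀ (n m d t : ℕ), 0 < n → 0 < m → 0 < t →
      ∀ (graph : SimpleGraph (Fin n)) (P : Matrix (Fin n) (Fin n) ℝ),
      DistSGD.IsCommMatrix graph P →
      -- `ρ⋆_Opt` and `ρ⋆_Test` minimise the first-order terms of the two bounds
      (DistSGD.IsUniquePosMin (DistSGD.optObjective L G σ κ (DistSGD.gap P) n t)
          (DistSGD.rhoOpt L G σ κ (DistSGD.gap P) n t) ∧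
        DistSGD.IsUniquePosMin (DistSGD.testObjective L G σ κ (DistSGD.gap P) n m t)
          (DistSGD.rhoTest L G σ κ (DistSGD.gap P) n m t)) ∧
      -- their sizes
      (DistSGD.rhoCentral L G c t ≤ C * (1 / √(t : ℝ)) ∧
        DistSGD.rhoOpt L G σ κ (DistSGD.gap P) n t
          ≤ C * DistSGD.logTerm n t ^ k * √(DistSGD.gap P / t) ∧
        DistSGD.rhoTest L G σ κ (DistSGD.gap P) n m t
          ≤ C * DistSGD.logTerm n t ^ k *
            (1 / √(t : ℝ) * (1 / √(9 / DistSGD.gap P + (t : ℝ) / ((n : ℝ) * m))))) ∧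
      -- the stopping times for `ρ⋆` and `ρ⋆_Opt` are of the order `n m / (1 - σ₂(P))`
      (DistSGD.IsUniquePosMin (DistSGD.centralTimeObjective L κ (DistSGD.gap P) n m)
          (3 * κ / (2 * L) * DistSGD.timeScale (DistSGD.gap P) n m) ∧
        DistSGD.IsUniquePosMin (DistSGD.optTimeObjective L κ (DistSGD.gap P) n m)
          (3 * κ / L * DistSGD.timeScale (DistSGD.gap P) n m)) ∧
      -- the test errors
      ∀ {𝒵 Ω : Type*} [MeasurableSpace 𝒵] [MeasurableSpace Ω]
        (Pr : MeasureTheory.Measure Ω) [MeasureTheory.IsProbabilityMeasure Pr]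
        (μ : MeasureTheory.Measure 𝒵) [MeasureTheory.IsProbabilityMeasure μ]
        (ℓ : DistSGD.Param d → 𝒵 → ℝ) (Z : Fin n → Fin m → Ω → 𝒵) (K : ℕ → Ω → Fin n → Fin m)
        (xstar : DistSGD.Param d) (Xstar : Ω → DistSGD.Param d),
        DistSGD.IsSmoothLoss μ ℓ L β →
        DistSGD.IsSampling Pr μ Z K →
        IsMinOn (DistSGD.testRisk μ ℓ) Set.univ xstar →
        DistSGD.IsEmpMinimiser Pr ℓ Z G Xstar →
        -- the choice `ρ⋆`: at every time, and at times of the order `n m / (1 - σ₂(P))`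
        (∀ η : ℝ, η = DistSGD.stepSize β (DistSGD.rhoCentral L G c t) →
          DistSGD.GradientBounds Pr ℓ P Z K σ κ η → ∀ v : Fin n,
          DistSGD.TestErrorLE Pr μ ℓ P Z K xstar η t v
            (C * DistSGD.logTerm n t ^ k *
              (1 / (DistSGD.gap P * √(t : ℝ)) + √(t : ℝ) / ((n : ℝ) * m))) ∧
          (DistSGD.timeScale (DistSGD.gap P) n m ≤ A * DistSGD.logTerm n t ^ j * t →
            t ≤ A * DistSGD.logTerm n t ^ j * DistSGD.timeScale (DistSGD.gap P) n m →
            DistSGD.TestErrorLE Pr μ ℓ P Z K xstar η t v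
              (C * DistSGD.logTerm n t ^ k * (1 / √((n : ℝ) * m * DistSGD.gap P))))) ∧
        -- the choice `ρ⋆_Opt`: at every time, and at times of the order `n m / (1 - σ₂(P))`
        (∀ η : ℝ, η = DistSGD.stepSize β (DistSGD.rhoOpt L G σ κ (DistSGD.gap P) n t) →
          DistSGD.GradientBounds Pr ℓ P Z K σ κ η → ∀ v : Fin n,
          DistSGD.TestErrorLE Pr μ ℓ P Z K xstar η t v
            (C * DistSGD.logTerm n t ^ k *
              (1 / √(t * DistSGD.gap P) + √(t * DistSGD.gap P) / ((n : ℝ) * m))) ∧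
          (DistSGD.timeScale (DistSGD.gap P) n m ≤ A * DistSGD.logTerm n t ^ j * t →
            t ≤ A * DistSGD.logTerm n t ^ j * DistSGD.timeScale (DistSGD.gap P) n m →
            DistSGD.TestErrorLE Pr μ ℓ P Z K xstar η t v
              (C * DistSGD.logTerm n t ^ k * (1 / √((n : ℝ) * m))))) ∧
        -- the choice `ρ⋆_Test`: at every time, and at times at least of the order `n m / (1 - σ₂(P))`
        (∀ η : ℝ, η = DistSGD.stepSize β (DistSGD.rhoTest L G σ κ (DistSGD.gap P) n m t) →
          DistSGD.GradientBounds Pr ℓ P Z K σ κ η → ∀ v : Fin n,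
          DistSGD.TestErrorLE Pr μ ℓ P Z K xstar η t v
            (C * DistSGD.logTerm n t ^ k *
              (1 / √(t * DistSGD.gap P) + 1 / √((n : ℝ) * m))) ∧
          (DistSGD.timeScale (DistSGD.gap P) n m ≤ A * DistSGD.logTerm n t ^ j * t →
            DistSGD.TestErrorLE Pr μ ℓ P Z K xstar η t v
              (C * DistSGD.logTerm n t ^ k * (1 / √((n : ℝ) * m))))) := by
  refine ⟨DistSGD.claimConst L β G σ κ c A j, DistSGD.claimConst_pos hL hβ hG hκ hc hA, j + 1, ?_⟩
  intro n m d t hn hm ht graph P hP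
  have hγ := hP.gap_pos
  have hγ1 := DistSGD.gap_le_one P
  have hΛ := DistSGD.half_le_logTerm hn ht
  have hn' : (0 : ℝ) < n := by exact_mod_cast hn
  have hm' : (0 : ℝ) < m := by exact_mod_cast hm
  have ht1 : (1 : ℝ) ≤ t := by exact_mod_cast ht
  have ht0 : (0 : ℝ) < t := by linarith
  have hN : (0 : ℝ) < (n : ℝ) * m := mul_pos hn' hm'
  obtain ⟨hC1, hC2, hC3, hC4⟩ :=
    DistSGD.rateConst_le_claimConst (σ := σ) (j := j) hL hβ hG hκ hc hA hΛ
  obtain ⟨hM1, hM2, hM3⟩ := DistSGD.rateConst_ge (σ := σ) hL hG hκ hc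
  set γ := DistSGD.gap P with hγdef
  set Λ := DistSGD.logTerm n t with hΛdef
  set C := DistSGD.claimConst L β G σ κ c A j
  set E := DistSGD.errorConst L β G
  set M := DistSGD.rateConst L G σ κ c
  have hΛ0 : 0 < Λ := by linarith
  have hE0 : 0 ≤ E := DistSGD.errorConst_nonneg hβ
  have hQ : 0 < DistSGD.optRadicand L σ κ γ Λ :=
    lt_of_lt_of_le (by positivity) (DistSGD.optRadicand_bounds hL hκ hγ hγ1 hΛ).1
  have hS : 0 < 2 * L ^ 2 * ((t : ℝ) + 1) / ((n : ℝ) * m) := by positivity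
  have hρC : 0 < DistSGD.rhoCentral L G c t := by unfold DistSGD.rhoCentral; positivity
  have hρO : 0 < DistSGD.rhoOpt L G σ κ γ n t :=
    mul_pos (by positivity) (one_div_pos.2 (Real.sqrt_pos.2 hQ))
  have hρT : 0 < DistSGD.rhoTest L G σ κ γ n m t :=
    mul_pos (by positivity) (one_div_pos.2 (Real.sqrt_pos.2 (add_pos hQ hS)))
  refine ⟨⟨?_, ?_⟩, ⟨?_, ?_, ?_⟩, ⟨?_, ?_⟩, ?_⟩
  · refine DistSGD.isUniquePosMin_div_sqrt hG ht0 hQ fun ρ hρ => ?_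
    simp only [DistSGD.optObjective]
    field_simp
    ring
  · refine DistSGD.isUniquePosMin_div_sqrt hG ht0 (add_pos hQ hS) fun ρ hρ => ?_
    simp only [DistSGD.testObjective, DistSGD.optObjective]
    field_simp
    ring
  · have h1 : DistSGD.rhoCentral L G c t = G / (L * c) * (1 / √(t : ℝ)) := by
      unfold DistSGD.rhoCentral; field_simp
    rw [h1]
    refine mul_le_mul_of_nonneg_right (le_trans ?_ hC2) (by positivity)
    have : 0 < L * c / G := by positivity
    linarith
  · refine (DistSGD.rhoOpt_size hL hG hκ hγ hγ1 hΛ).trans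
      (mul_le_mul_of_nonneg_right (le_trans ?_ hC1) (Real.sqrt_nonneg _))
    have h1 : 0 ≤ √(6 * L * κ + σ ^ 2) / G := by positivity
    have h2 : 0 < 2 * L / G := by positivity
    have h3 : 0 < G / L := by positivity
    linarith
  · exact (DistSGD.rhoTest_size hL hG hκ hγ hγ1 hΛ ht0 hN).trans
      (mul_le_mul_of_nonneg_right (hM3.trans hC1) (by positivity))
  · exact DistSGD.isUniquePosMin_centralTimeObjective hL hκ hγ hn hm
  · exact DistSGD.isUniquePosMin_optTimeObjective hL hκ hγ hn hm
  intro 𝒵 Ω _ _ Pr _ μ _ ℓ Z K xstar Xstar hℓ hSamp _ hX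
  have herr : ∀ ρ, 0 < ρ → ∀ v, DistSGD.TestErrorLE Pr μ ℓ P Z K xstar (DistSGD.stepSize β ρ) t v
      (E * (1 / t + 1 / (ρ * t) + ρ * (Λ / γ) + ρ * t / ((n : ℝ) * m))) := fun ρ hρ v =>
    (DistSGD.testErrorLE_of_stepSize hn hm hP hℓ hSamp hL.le hβ (DistSGD.stepSize_pos hβ hρ)
      (DistSGD.stepSize_mul_le hβ hρ) hX xstar ht v).mono
      (DistSGD.error_terms_le hβ hρ hγ hγ1 hΛ ht0 hN)
  -- `hall` gives the bounds at every time; `hwin` gives those in the time window, where the two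
  -- summands of `Y` are of the same order `W` up to logarithms.
  have hall : ∀ {B Y : ℝ}, B ≤ M * (2 * Λ) * Y → 0 ≤ Y → E * B ≤ C * Λ ^ (j + 1) * Y := by
    intro B Y hB hY
    calc E * B ≤ E * (M * (2 * Λ) * Y) := mul_le_mul_of_nonneg_left hB hE0
      _ = E * (M * (2 * Λ)) * Y := by ring
      _ ≤ _ := mul_le_mul_of_nonneg_right hC3 hY
  have hwin : ∀ {B Y W : ℝ}, B ≤ M * (2 * Λ) * Y → Y ≤ 2 * ((1 + A) * (2 * Λ) ^ j) * W → 0 ≤ W →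
      E * B ≤ C * Λ ^ (j + 1) * W := by
    intro B Y W hB hY hW
    have hM0 : 0 ≤ M := le_trans zero_le_one (DistSGD.one_le_rateConst hL hG hκ hc)
    calc E * B ≤ E * (M * (2 * Λ) * Y) := mul_le_mul_of_nonneg_left hB hE0
      _ ≤ E * (M * (2 * Λ) * (2 * ((1 + A) * (2 * Λ) ^ j) * W)) := by gcongr
      _ = E * (M * (2 * Λ)) * (2 * ((1 + A) * (2 * Λ) ^ j)) * W := by ring
      _ ≤ _ := mul_le_mul_of_nonneg_right hC4 hW
  have hlate : DistSGD.timeScale γ n m ≤ A * Λ ^ j * t →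
      √((n : ℝ) * m / γ) ≤ (1 + A) * (2 * Λ) ^ j * √(t : ℝ) := fun h =>
    DistSGD.sqrt_le_window hA hΛ0 rfl (by linarith) h ht0.le
  have hearly : t ≤ A * Λ ^ j * DistSGD.timeScale γ n m →
      √(t : ℝ) ≤ (1 + A) * (2 * Λ) ^ j * √((n : ℝ) * m / γ) := fun h =>
    DistSGD.sqrt_le_window hA hΛ0 rfl (by linarith) h (by positivity)
  refine ⟨?_, ?_, ?_⟩
  · rintro η rfl - v
    have hB := DistSGD.central_terms_le (σ := σ) (ρ := DistSGD.rhoCentral L G c t) hL hG hκ hc hγ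
      hγ1 hΛ ht1 hN rfl
    refine ⟨(herr _ hρC v).mono (hall hB (by positivity)), fun h1 h2 => (herr _ hρC v).mono
      (hwin hB ?_ (by positivity))⟩
    have h3 := (DistSGD.terms_le_of_late hγ ht0 hN (hlate h1)).1
    have h4 := (DistSGD.terms_le_of_early hγ ht0 hN (hearly h2)).1
    linarith
  · rintro η rfl - v
    have hB := DistSGD.opt_terms_le (c := c) (ρ := DistSGD.rhoOpt L G σ κ γ n t) hL hG hκ hc hγ
      hγ1 hΛ ht1 hN rfl
    refine ⟨(herr _ hρO v).mono (hall hB (by positivity)), fun h1 h2 => (herr _ hρO v).mono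
      (hwin hB ?_ (by positivity))⟩
    have h3 := (DistSGD.terms_le_of_late hγ ht0 hN (hlate h1)).2
    have h4 := (DistSGD.terms_le_of_early hγ ht0 hN (hearly h2)).2
    linarith
  · rintro η rfl - v
    have hB := DistSGD.test_terms_le (c := c) (ρ := DistSGD.rhoTest L G σ κ γ n m t) hL hG hκ hc
      hγ hγ1 hΛ ht1 hN rfl
    refine ⟨(herr _ hρT v).mono (hall hB (by positivity)), fun h1 => (herr _ hρT v).mono
      (hwin hB ?_ (by positivity))⟩
    have h3 := (DistSGD.terms_le_of_late hγ ht0 hN (hlate h1)).2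
    have h4 : 1 ≤ (1 + A) * (2 * Λ) ^ j := by
      have : (1 : ℝ) ≤ (2 * Λ) ^ j := one_le_pow₀ (by linarith)
      nlinarith
    have h5 : 1 / √((n : ℝ) * m) ≤ (1 + A) * (2 * Λ) ^ j * (1 / √((n : ℝ) * m)) :=
      le_mul_of_one_le_left (by positivity) h4
    linarith
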